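/- For positive integers $k<n$ and $\epsilon\in[0,1]$, an $(n,k,\epsilon)$-selector is a family $\mathcal S$ of subsets of $[n]$ such that for every two disjoint sets $L,S\subseteq[n]$ with $\epsilon k<|L|\le k$ and $|S|\le k$ there is a set $U\in\mathcal S$ with $|U\cap L|=1$ and $|U\cap S|=0$. Theorem. There are a deterministic algorithm $P$ and a threshold $\tilde k=\tilde k(n,\epsilon)\in\mathbb R$ such that for every function $\psi:\mathbb N\to\mathbb R$ with $\psi(n)\to0$ there is a function $g:\mathbb N\to\mathbb R$ with $g(n)\to0$ for which the following holds. Let $n\in\mathbb N$ and let $\epsilon$ be a real number with $n^{-\psi(n)}\le\epsilon\le1$. Then $\tilde k(n,\epsilon)\ge n^{1-g(n)}$, and for every integer $k$ with $1\le k<n$ and $k\le\tilde k(n,\epsilon)$ the algorithm $P$, on the input $n$, $k$, $\lceil 1/\epsilon\rceil$, outputs within time $n^{1+g(n)}$ an explicit list of at most $k\cdot n^{g(n)}$ subsets of $[n]$ (each written out element by element), which form an $(n,k,\epsilon)$-selector and each of which has size at least $2$. Here an algorithm is a program of a random access machine with logarithmic cost: every operation is charged one unit plus the total bit length of the numbers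 and memory addresses it handles. -/

import Mathlib

open Filter Topology

/-! ## The machine model: a random access machine with logarithmic cost

A machine has registers, a random access memory and a write-only output, all holding natural
numbers. Programs are written in structured form (assignment, store, output, sequencing,
conditional, loop). Every operation is charged one unit plus the total bit length of the numbers
and memory addresses that it handles, so that arithmetic on long numbers is not free. -/

namespace LogRAM

/-- The configuration of a machine. -/
structure State where
  /-- the registers -/
  reg : ℕ → ℕ
  /-- the random access memory -/
  mem : ℕ → ℕ
  /-- the numbers written so far, in the order of writing -/
  out : List ℕ

/-- The elementary binary operations. -/
inductive Op
  | add | sub | mul | div | mod | and | or | xor | lt | eq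

/-- The result of an elementary operation: `sub` is truncated at zero, division by zero gives
zero, `and`, `or`, `xor` act bitwise, and the two comparisons return `1` or `0`. -/
def Op.eval : Op → ℕ → ℕ → ℕ
  | add, x, y => x + y
  | sub, x, y => x - y
  | mul, x, y => x * y
  | div, x, y => x / y
  | mod, x, y => x % y
  | and, x, y => x &&& y
  | or, x, y => x ||| y
  | xor, x, y => x ^^^ y
  | lt, x, y => if x < y then 1 else 0
  | eq, x, y => if x = y then 1 else 0

/-- Expressions: a constant, the content of a register, the content of the memory cell whose
address is the value of an expression, an elementary operation. -/
inductive Expr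
  | lit (c : ℕ)
  | reg (i : ℕ)
  | load (a : Expr)
  | op (o : Op) (x y : Expr)

/-- The value of an expression. -/
def Expr.eval (s : State) : Expr → ℕ
  | lit c => c
  | reg i => s.reg i
  | load a => s.mem (a.eval s)
  | op o x y => o.eval (x.eval s) (y.eval s)

/-- The time to evaluate an expression (`Nat.size` is the bit length). -/
def Expr.cost (s : State) : Expr → ℕ
  | lit c => 1 + c.size
  | reg i => 1 + (s.reg i).size
  | load a => a.cost s + (1 + (a.eval s).size + (s.mem (a.eval s)).size)
  | op o x y => x.cost s + y.cost s +
      (1 + (x.eval s).size + (y.eval s).size + (o.eval (x.eval s) (y.eval s)).size)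

/-- Programs. -/
inductive Prog
  /-- do nothing -/
  | nop
  /-- `assign i e`: put the value of `e` into register `i` -/
  | assign (i : ℕ) (e : Expr)
  /-- `store a e`: put the value of `e` into the memory cell with address `a` -/
  | store (a e : Expr)
  /-- `write e`: append the value of `e` to the output -/
  | write (e : Expr)
  /-- `seq p q`: first `p`, then `q` -/
  | seq (p q : Prog)
  /-- `ite c p q`: `p` if the value of `c` is not zero, otherwise `q` -/
  | ite (c : Expr) (p q : Prog)
  /-- `loop c p`: repeat `p` as long as the value of `c` is not zero -/
  | loop (c : Expr) (p : Prog)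

/-- `Runs p s t u`: started in the state `s`, the program `p` halts after time exactly `t` in the
state `u`. -/
inductive Runs : Prog → State → ℕ → State → Prop
  | nop (s : State) : Runs Prog.nop s 1 s
  | assign (i : ℕ) (e : Expr) (s : State) :
      Runs (Prog.assign i e) s (e.cost s + 1)
        { s with reg := Function.update s.reg i (e.eval s) }
  | store (a e : Expr) (s : State) :
      Runs (Prog.store a e) s (a.cost s + e.cost s + 1)
        { s with mem := Function.update s.mem (a.eval s) (e.eval s) }
  | write (e : Expr) (s : State) :
      Runs (Prog.write e) s (e.cost s + 1) { s with out := s.out ++ [e.eval s] }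
  | seq {p q : Prog} {s₁ s₂ s₃ : State} {t₁ t₂ : ℕ} :
      Runs p s₁ t₁ s₂ → Runs q s₂ t₂ s₃ → Runs (Prog.seq p q) s₁ (t₁ + t₂) s₃
  | ite_true {c : Expr} {p q : Prog} {s₁ s₂ : State} {t : ℕ} :
      c.eval s₁ ≠ 0 → Runs p s₁ t s₂ → Runs (Prog.ite c p q) s₁ (c.cost s₁ + 1 + t) s₂
  | ite_false {c : Expr} {p q : Prog} {s₁ s₂ : State} {t : ℕ} :
      c.eval s₁ = 0 → Runs q s₁ t s₂ → Runs (Prog.ite c p q) s₁ (c.cost s₁ + 1 + t) s₂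
  | loop_done {c : Expr} {p : Prog} {s : State} :
      c.eval s = 0 → Runs (Prog.loop c p) s (c.cost s + 1) s
  | loop_step {c : Expr} {p : Prog} {s₁ s₂ s₃ : State} {t₁ t₂ : ℕ} :
      c.eval s₁ ≠ 0 → Runs p s₁ t₁ s₂ → Runs (Prog.loop c p) s₂ t₂ s₃ →
        Runs (Prog.loop c p) s₁ (c.cost s₁ + 1 + t₁ + t₂) s₃

/-- The initial state on a list of numbers: register `i` holds the `i`-th number, all other
registers and the whole memory hold zero, and the output is empty. -/
def start (input : List ℕ) : State where
  reg := fun i => input.getD i 0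
  mem := fun _ => 0
  out := []

end LogRAM

/-! ## Selectors -/

/-- `𝒮` is an `(n, k, ε)`-selector: for all disjoint `L, S ⊆ [n]` with `ε k < |L| ≤ k` and
`|S| ≤ k`, some member of `𝒮` hits `L` exactly once and misses `S`. -/
def IsSelector (n k : ℕ) (ε : ℝ) (𝒮 : Set (Finset (Fin n))) : Prop :=
  ∀ L S : Finset (Fin n), Disjoint L S → ε * k < L.card → L.card ≤ k → S.card ≤ k →
    ∃ U ∈ 𝒮, (U ∩ L).card = 1 ∧ (U ∩ S).card = 0

/-- The family of sets described by a list of lists of elements. -/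
def familyOf {n : ℕ} (F : List (List (Fin n))) : Set (Finset (Fin n)) :=
  {U | ∃ l ∈ F, l.toFinset = U}

/-- How a family is written down explicitly: set after set, the elements of `[n]` written as
`1, …, n`, and a `0` after the last element of each set. -/
def encodeFamily {n : ℕ} (F : List (List (Fin n))) : List ℕ :=
  F.flatMap fun l => l.map (fun x => (x : ℕ) + 1) ++ [0]

/-!
The selectors come from the unbalanced expanders of multiplicity codes. Identify `x ∈ [n]` with the
polynomial `f_x` over `ZMod p` whose coefficients are the base `p` digits of `x`; it has degree less
than `m`, the bit length of `n`. For a point `y`, the label of `x` at `y` is `f_x` modulo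
`(X - y) ^ σ`, and the family consists of the `p * p ^ σ` sets of all `x` with a given label at a
given point.

*Isolation.* Let `T = L ∪ S`. A nonzero polynomial `Q(X, Y_0, …, Y_(σ-1))` of small degree satisfies
`Q(X, f, f', …) = 0` for all `f = f_x`, `x ∈ T`, by counting coefficients. Take one of least total
degree, and let `Y_i` be its last variable. By minimality `∂Q/∂Y_i` does not vanish identically on
some `f`, and outside the few roots of `(∂Q/∂Y_i)[f]` the differential equation `Q = 0` determines
`f` from its label (`eq_of_pow_dvd_sub`, `exists_mem_card_collisions_le`). So every subset of `T`
has a member with few collisions, hence there are few collisions in `T` altogether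
(`card_collisions_le`), and if `p` is large enough some element of `L` has at some point a label of
its own (`exists_isolating_label`). Each set contains exactly one element of each complete block of
`p ^ σ` consecutive numbers (`exists_label_eq`), so it has at least two elements if `2 * p ^ σ ≤ n`.

*Parameters.* With `e = ⌈1 / ε⌉` and `β = e * m` and with exponents less than `h` for each `Y_j` in
`Q`, it suffices that `h ^ σ > 32 * e * k` and that `p` is a prime above `8 * e * σ * h * m`. Then
`p ^ σ` is at most `k * β ^ O(σ)`, and the choice of `σ` as the least number with `n ≤ β ^ σ ^ 2`
makes `p` and `β ^ O(σ)` at most `n ^ o(1)`, because `log β / log n` tends to zero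
(`exists_isParams`, `pow_rootExp_le_rpow`). The threshold is `n / β ^ (100 * (σ + 1))`.

*Algorithm.* The Taylor coefficients of `f_x` at `y`, computed over the integers, are less than `n`,
so they are the base `n` digits of the single number `f_x(n + y)`. For each pair `(y, x)` the
program computes this number, reads off the label and stores `x` in a table that has one cell for
each label and each block; afterwards it writes out the table. There are `p * n` pairs, and each
costs a polynomial in `m` (`LogRAM.does_selectorProg`). The time is accounted for in units of
`W + 1`, where `W` bounds the bit length of all stored numbers (`LogRAM.Does`).
-/

/-! ### Vanishing polynomials in a function and its derivatives -/

section Expander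

open Polynomial

/-- First order Taylor expansion in one variable, exact for an increment of square zero. -/
theorem MvPolynomial.aeval_update_add {R S ι : Type*} [CommRing R] [CommRing S] [Algebra R S]
    [DecidableEq ι] (b : ι → S) (i : ι) (u : S) (hu : u * u = 0) (Q : MvPolynomial ι R) :
    MvPolynomial.aeval (Function.update b i (b i + u)) Q =
      MvPolynomial.aeval b Q + u * MvPolynomial.aeval b (MvPolynomial.pderiv i Q) := by
  induction Q using MvPolynomial.induction_on with
  | C a => simp
  | add p q hp hq => simp only [map_add, hp, hq]; ring
  | mul_X p j hp =>
    rw [map_mul, hp, MvPolynomial.pderiv_mul]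
    by_cases hj : j = i
    · subst hj
      simp only [MvPolynomial.aeval_X, Function.update_self, map_mul, map_add,
        MvPolynomial.pderiv_X_self, map_one]
      linear_combination (MvPolynomial.aeval b (MvPolynomial.pderiv j p)) * hu
    · simp only [MvPolynomial.aeval_X, Function.update_of_ne hj, map_mul, map_add,
        MvPolynomial.pderiv_X_of_ne hj, map_zero]
      ring

variable {F : Type*} [Field F] {σ : ℕ}

/-- The value `Q(X, f, f', …, f⁽σ⁻¹⁾)`. -/
noncomputable def diffEval (f : F[X]) (Q : MvPolynomial (Fin σ) F[X]) : F[X] :=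
  MvPolynomial.aeval (fun j : Fin σ => derivative^[(j : ℕ)] f) Q

/-- `Q` has degree less than `h` in each variable `Y_j`, and its coefficients, which are polynomials
in `X`, have degree less than `a`. -/
def InBox (a h : ℕ) (Q : MvPolynomial (Fin σ) F[X]) : Prop :=
  ∀ b ∈ Q.support, (∀ j, b j < h) ∧ (Q.coeff b).natDegree < a

theorem InBox.pderiv {a h : ℕ} {Q : MvPolynomial (Fin σ) F[X]} (hQ : InBox a h Q) (i : Fin σ) :
    InBox a h (MvPolynomial.pderiv i Q) := by
  intro b hb
  rw [MvPolynomial.mem_support_iff, MvPolynomial.coeff_pderiv] at hb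
  have h1 := hQ (b + Finsupp.single i 1)
    (MvPolynomial.mem_support_iff.2 fun h0 => hb (by rw [h0, zero_mul]))
  refine ⟨fun j => lt_of_le_of_lt ?_ (h1.1 j), ?_⟩
  · simp
  · rw [MvPolynomial.coeff_pderiv]
    refine lt_of_le_of_lt natDegree_mul_le ?_
    have : ((b i : F[X]) + 1).natDegree = 0 := by
      rw [← Nat.cast_succ]; exact natDegree_natCast _
    omega

/-- The degree is less than `a + σ * h * m` because each of the `σ` derivatives has degree less than
`m` and enters with an exponent less than `h`. -/
theorem natDegree_diffEval_lt {a h m : ℕ} (ha : 0 < a) {Q : MvPolynomial (Fin σ) F[X]}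
    (hQ : InBox a h Q) {f : F[X]} (hf : f.natDegree < m) :
    (diffEval f Q).natDegree < a + σ * h * m := by
  have key : (diffEval f Q).natDegree ≤ (a - 1) + σ * h * m := by
    rw [diffEval, MvPolynomial.aeval_def, MvPolynomial.eval₂_eq']
    refine natDegree_sum_le_of_forall_le _ _ fun b hb => ?_
    obtain ⟨h1, h2⟩ := hQ b hb
    refine natDegree_mul_le.trans (add_le_add (by simp; omega) ?_)
    refine (natDegree_prod_le _ _).trans ?_
    refine (Finset.sum_le_card_nsmul _ _ (h * m) fun j _ => ?_).trans (by simp [mul_assoc])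
    refine natDegree_pow_le.trans (Nat.mul_le_mul (h1 j).le ?_)
    exact ((natDegree_iterate_derivative _ _).trans (Nat.sub_le _ _)).trans hf.le
  omega

/-- The vanishing conditions are `|F| * |T|` linear equations for the `a * h ^ σ` coefficients. -/
theorem exists_inBox_forall_eval_eq_zero [Fintype F] {a h : ℕ} (T : Finset F[X])
    (hcard : Fintype.card F * T.card < a * h ^ σ) :
    ∃ Q : MvPolynomial (Fin σ) F[X], Q ≠ 0 ∧ InBox a h Q ∧
      ∀ f ∈ T, ∀ y, (diffEval f Q).eval y = 0 := by
  classical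
  let e : (Fin σ → Fin h) → (Fin σ →₀ ℕ) := fun b =>
    Finsupp.equivFunOnFinite.symm fun j => (b j : ℕ)
  have he : Function.Injective e := by
    intro b b' hb
    ext j
    exact DFunLike.congr_fun hb j
  let P : (Fin a → F) →ₗ[F] F[X] := ∑ i : Fin a, (monomial (i : ℕ)).comp (LinearMap.proj i)
  have hP : ∀ c i, (P c).coeff i = if hi : i < a then c ⟨i, hi⟩ else 0 := by
    intro c i
    simp only [P, LinearMap.sum_apply, LinearMap.comp_apply, LinearMap.proj_apply,
      finsetSum_coeff, coeff_monomial]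
    split_ifs with hi
    · rw [Finset.sum_eq_single ⟨i, hi⟩] <;> simp +contextual [Fin.ext_iff]
    · exact Finset.sum_eq_zero fun j _ => if_neg (by omega)
  let G : ((Fin σ → Fin h) → Fin a → F) → MvPolynomial (Fin σ) F[X] :=
    fun c => ∑ b, MvPolynomial.monomial (e b) (P (c b))
  have hG : ∀ c b, (G c).coeff (e b) = P (c b) := by
    intro c b
    simp only [G, MvPolynomial.coeff_sum, MvPolynomial.coeff_monomial]
    rw [Finset.sum_eq_single b] <;> simp +contextual [he.eq_iff]
  let Φ : ((Fin σ → Fin h) → Fin a → F) →ₗ[F] (T × F → F) :=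
    { toFun := fun c z => (diffEval z.1.1 (G c)).eval z.2
      map_add' := by
        intro c c'; ext z
        simp [G, diffEval, Finset.sum_add_distrib, map_sum]
      map_smul' := by
        intro t c; ext z
        have hGt : G (t • c) = MvPolynomial.C (C t) * G c := by
          simp only [G, Pi.smul_apply, map_smul, Finset.mul_sum, MvPolynomial.C_mul_monomial,
            smul_eq_C_mul]
        simp [hGt, diffEval] }
  have hlt : Module.finrank F (T × F → F) < Module.finrank F ((Fin σ → Fin h) → Fin a → F) := by
    rw [Module.finrank_pi, Module.finrank_pi_fintype]
    simp only [Module.finrank_fin_fun, Finset.sum_const, Finset.card_univ, Fintype.card_prod,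
      Fintype.card_coe, Fintype.card_fun, Fintype.card_fin, smul_eq_mul]
    linarith [mul_comm T.card (Fintype.card F), mul_comm a (h ^ σ)]
  obtain ⟨c, hc, hc0⟩ := (Submodule.ne_bot_iff _).1 (Φ.ker_ne_bot_of_finrank_lt hlt)
  refine ⟨G c, fun h0 => hc0 ?_, ?_, fun f hf y => ?_⟩
  · ext b i
    have h1 := hP (c b) i
    rw [← hG, h0] at h1
    simpa using h1.symm
  · intro d hd
    have : ∃ b, d = e b := by
      by_contra hcon
      push Not at hcon
      refine MvPolynomial.mem_support_iff.1 hd ?_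
      simp only [G, MvPolynomial.coeff_sum, MvPolynomial.coeff_monomial]
      exact Finset.sum_eq_zero fun b _ => if_neg fun h => hcon b h.symm
    obtain ⟨b, rfl⟩ := this
    refine ⟨fun j => (b j).2, ?_⟩
    have h0 : P (c b) ≠ 0 := by rw [← hG]; exact MvPolynomial.mem_support_iff.1 hd
    rw [hG, natDegree_lt_iff_degree_lt h0, degree_lt_iff_coeff_zero]
    intro i hi
    rw [hP, dif_neg (by omega)]
  · exact congrFun (LinearMap.mem_ker.1 hc) (⟨f, hf⟩, y)

/-- The differential equation `Q(X, f, f', …) = 0` determines `f` from its jet at a point `y` that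
is not singular for `f`, where `i` is the highest derivative that occurs in `Q`. If `f ≠ g` were two
solutions and `r ≥ σ` the order of vanishing of `g - f` at `y`, the Taylor expansion of `Q` around
the jet of `f`, taken modulo `(X - y)^(r - i + 1)`, would give `(∂Q/∂Y_i)[f] * (g - f)⁽ⁱ⁾ = 0`,
while `(g - f)⁽ⁱ⁾` vanishes at `y` to order exactly `r - i`, because `r` is less than the
characteristic. -/
theorem eq_of_pow_dvd_sub {p : ℕ} [CharP F p] {m : ℕ} (hm : m ≤ p)
    {Q : MvPolynomial (Fin σ) F[X]} {i : Fin σ} (hi : ∀ j ∈ Q.vars, j ≤ i) {f g : F[X]}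
    (hfm : f.natDegree < m) (hgm : g.natDegree < m)
    (hf : diffEval f Q = 0) (hg : diffEval g Q = 0) {y : F}
    (hy : (diffEval f (MvPolynomial.pderiv i Q)).eval y ≠ 0)
    (hfg : (X - C y) ^ σ ∣ f - g) : f = g := by
  classical
  by_contra hne
  have hsub : g - f ≠ 0 := sub_ne_zero.2 (Ne.symm hne)
  have hfg' : (X - C y) ^ σ ∣ g - f := by
    rw [← neg_sub f g]; exact (dvd_neg).2 hfg
  set d := g - f with hd
  set r := d.rootMultiplicity y with hr
  have hσr : σ ≤ r := (le_rootMultiplicity_iff hsub).2 hfg'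
  have hrm : r < m := by
    have h1 := natDegree_le_of_dvd (pow_rootMultiplicity_dvd d y) hsub
    rw [natDegree_pow, natDegree_X_sub_C, mul_one] at h1
    exact lt_of_le_of_lt h1 (lt_of_le_of_lt (natDegree_sub_le _ _) (max_lt hgm hfm))
  have hir : (i : ℕ) < r := lt_of_lt_of_le i.2 hσr
  have hdr : (X - C y) ^ r ∣ d := pow_rootMultiplicity_dvd d y
  -- only the derivative of order `i` can differ modulo `(X - y) ^ (r - i + 1)`
  have hder : ∀ j, (X - C y) ^ (r - j) ∣ derivative^[j] d := fun j =>
    pow_sub_dvd_iterate_derivative_of_pow_dvd j hdr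
  let I : Ideal F[X] := Ideal.span {(X - C y) ^ (r - i + 1)}
  let π : F[X] →ₐ[F[X]] F[X] ⧸ I := Ideal.Quotient.mkₐ F[X] I
  have hπ : ∀ q, π q = 0 ↔ (X - C y) ^ (r - i + 1) ∣ q := fun q => by
    rw [← Ideal.mem_span_singleton]; exact Ideal.Quotient.eq_zero_iff_mem
  let b : Fin σ → F[X] ⧸ I := fun j => π (derivative^[(j : ℕ)] f)
  set u := π (derivative^[(i : ℕ)] d) with hu
  have huu : u * u = 0 := by
    rw [hu, ← map_mul, hπ]
    refine dvd_trans ?_ (mul_dvd_mul (hder i) (hder i))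
    rw [← pow_add]
    exact pow_dvd_pow _ (by omega)
  have haev : ∀ q R, MvPolynomial.aeval (fun j : Fin σ => π (derivative^[(j : ℕ)] q)) R =
      π (diffEval q R) := by
    intro q R
    rw [diffEval, ← MvPolynomial.comp_aeval_apply]
  have h1 := MvPolynomial.aeval_update_add b i u huu Q
  have h2 : MvPolynomial.aeval (Function.update b i (b i + u)) Q =
      MvPolynomial.aeval (fun j : Fin σ => π (derivative^[(j : ℕ)] g)) Q := by
    refine MvPolynomial.eval₂Hom_congr' rfl (fun j hj _ => ?_) rfl
    have hgd : g = f + d := by rw [hd]; ring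
    rcases eq_or_ne j i with rfl | hji
    · simp only [Function.update_self, b, hu]
      rw [← map_add, hgd, iterate_map_add derivative]
    · rw [Function.update_of_ne hji]
      simp only [b]
      rw [hgd, iterate_map_add derivative, map_add, left_eq_add, hπ]
      refine dvd_trans (pow_dvd_pow _ ?_) (hder j)
      have : (j : ℕ) < i := lt_of_le_of_ne (hi j hj) (fun h => hji (Fin.ext h))
      omega
  rw [h2, haev, hg] at h1
  simp only [b] at h1
  rw [haev, haev, hf, map_zero, zero_add, hu, ← map_mul, eq_comm, hπ] at h1
  have hcop : IsCoprime ((X - C y) ^ (r - i + 1)) (diffEval f (MvPolynomial.pderiv i Q)) := by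
    refine IsCoprime.pow_left ?_
    refine (irreducible_X_sub_C y).coprime_iff_not_dvd.2 fun h => hy ?_
    exact dvd_iff_isRoot.1 h
  have h3 := hcop.dvd_of_dvd_mul_right h1
  have h4 := pow_sub_dvd_iterate_derivative_of_pow_dvd (r - i) h3
  rw [← Function.iterate_add_apply, Nat.sub_add_cancel hir.le, Nat.add_sub_cancel_left, pow_one,
    dvd_iff_isRoot, IsRoot.def, hr, eval_iterate_derivative_rootMultiplicity, nsmul_eq_mul,
    mul_eq_zero] at h4
  rcases h4 with h4 | h4
  · have hp0 : p ≠ 0 := by omega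
    have hp : p.Prime := (CharP.char_is_prime_or_zero F p).resolve_right hp0
    rw [CharP.cast_eq_zero_iff F p, hp.dvd_factorial] at h4
    omega
  · exact eval_divByMonic_pow_rootMultiplicity_ne_zero y hsub h4

/-- Among any small set `T` of polynomials there is one that collides, to order `σ`, with another
member of `T` only at few points. It is a polynomial on which the derivative `∂Q/∂Y_i` of a nonzero
`Q` of least total degree that kills all of `T` does not vanish. -/
theorem exists_mem_card_collisions_le [Fintype F] [DecidableEq F] {p : ℕ} [CharP F p]
    (hpF : Fintype.card F = p) {a h m : ℕ} (ha : 0 < a) (hmp : m ≤ p) (hhp : h ≤ p)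
    (hD : a + σ * h * m ≤ p) {T : Finset F[X]}
    (hT : T.Nonempty) (hTm : ∀ f ∈ T, f.natDegree < m) (hcard : p * T.card < a * h ^ σ) :
    ∃ f ∈ T, ∃ R : Finset F, R.card ≤ a + σ * h * m ∧
      ∀ y ∉ R, ∀ g ∈ T, (X - C y) ^ σ ∣ f - g → f = g := by
  classical
  have hex : ∃ n, ∃ Q : MvPolynomial (Fin σ) F[X], Q.totalDegree = n ∧ Q ≠ 0 ∧ InBox a h Q ∧
      ∀ f ∈ T, diffEval f Q = 0 := by
    obtain ⟨Q, hQ, hB, hz⟩ := exists_inBox_forall_eval_eq_zero (σ := σ) (a := a) (h := h) T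
      (by rw [hpF]; exact hcard)
    refine ⟨_, Q, rfl, hQ, hB, fun f hf => ?_⟩
    refine eq_zero_of_natDegree_lt_card_of_eval_eq_zero _ Function.injective_id (hz f hf) ?_
    rw [hpF]
    exact (natDegree_diffEval_lt ha hB (hTm f hf)).trans_le hD
  obtain ⟨Q, hQn, hQ, hB, hz⟩ := Nat.find_spec hex
  have hmin : ∀ Q' : MvPolynomial (Fin σ) F[X], Q'.totalDegree < Q.totalDegree → Q' ≠ 0 →
      InBox a h Q' → ∃ f ∈ T, diffEval f Q' ≠ 0 := by
    intro Q' hlt h0 hb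
    by_contra hcon
    push Not at hcon
    rw [hQn] at hlt
    exact Nat.find_min hex hlt ⟨Q', rfl, h0, hb, hcon⟩
  have hvars : Q.vars.Nonempty := by
    by_contra hcon
    rw [Finset.not_nonempty_iff_eq_empty, MvPolynomial.vars_eq_empty_iff_eq_C] at hcon
    obtain ⟨f, hf⟩ := hT
    have := hz f hf
    rw [hcon, diffEval, MvPolynomial.aeval_C] at this
    exact hQ (by rw [hcon]; simpa using this)
  set i := Q.vars.max' hvars with hi
  have himax : ∀ j ∈ Q.vars, j ≤ i := fun j hj => Q.vars.le_max' j hj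
  obtain ⟨b, hb, hbi⟩ := (MvPolynomial.mem_vars_iff_mem_support i).1 (Q.vars.max'_mem hvars)
  have hbi' : b i ≠ 0 := Finsupp.mem_support_iff.1 hbi
  have hR0 : MvPolynomial.pderiv i Q ≠ 0 := by
    intro h0
    have h1 := MvPolynomial.coeff_pderiv (i := i) Q (b - Finsupp.single i 1)
    rw [h0, MvPolynomial.coeff_zero, Finsupp.sub_add_single_one_cancel hbi'] at h1
    rcases mul_eq_zero.1 h1.symm with h2 | h2
    · exact MvPolynomial.mem_support_iff.1 hb h2
    · have h3 : ((b i : ℕ) : F[X]) = 0 := by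
        rw [← h2]
        simp only [Finsupp.coe_tsub, Pi.sub_apply, Finsupp.single_eq_same]
        rw [← Nat.cast_succ, Nat.succ_eq_add_one, Nat.sub_add_cancel (by omega)]
      rw [CharP.cast_eq_zero_iff F[X] p] at h3
      have := Nat.le_of_dvd (by omega) h3
      have := (hB b hb).1 i
      omega
  have hdeg : (MvPolynomial.pderiv i Q).totalDegree < Q.totalDegree := by
    have hpos : 0 < Q.totalDegree := by
      have h1 := MvPolynomial.le_totalDegree hb
      have h2 : b i ≤ b.sum fun _ e => e := by
        rw [Finsupp.sum]
        exact Finset.single_le_sum (f := fun j => b j) (fun _ _ => Nat.zero_le _) hbi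
      omega
    rw [MvPolynomial.totalDegree, Finset.sup_lt_iff hpos]
    intro c hc
    rw [MvPolynomial.mem_support_iff, MvPolynomial.coeff_pderiv] at hc
    have h1 := MvPolynomial.le_totalDegree (p := Q) (s := c + Finsupp.single i 1)
      (MvPolynomial.mem_support_iff.2 fun h0 => hc (by rw [h0, zero_mul]))
    rw [Finsupp.sum_add_index' (by simp) (by simp), Finsupp.sum_single_index rfl] at h1
    omega
  obtain ⟨f, hf, hfR⟩ := hmin _ hdeg hR0 (hB.pderiv i)
  refine ⟨f, hf, (diffEval f (MvPolynomial.pderiv i Q)).roots.toFinset, ?_, ?_⟩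
  · exact (Multiset.toFinset_card_le _).trans ((card_roots' _).trans
      (natDegree_diffEval_lt ha (hB.pderiv i) (hTm f hf)).le)
  · intro y hy g hg hdvd
    refine eq_of_pow_dvd_sub hmp himax (hTm f hf) (hTm g hg) (hz f hf) (hz g hg) (y := y) ?_ hdvd
    simpa [hfR] using hy

end Expander

/-! ### From few collisions to an isolated element -/

section Isolation

/-- If each subset of `T` has a member that collides in it for at most `D` values of `y`, there are
at most `2 * D * |T|` colliding pairs: removing this member `f` destroys its own at most `D`
collisions, and at most one further pair `(g, y)` for each of them, since two would still collide
with each other. -/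
theorem card_collisions_le {α Y Λ : Type*} [DecidableEq α] [Fintype Y] [DecidableEq Y]
    [DecidableEq Λ] (c : Y → α → Λ) (D : ℕ) (T : Finset α)
    (H : ∀ T' ⊆ T, T'.Nonempty → ∃ f ∈ T', ∃ R : Finset Y, R.card ≤ D ∧
      ∀ y ∉ R, ∀ g ∈ T', c y f = c y g → f = g) :
    ((T ×ˢ (Finset.univ : Finset Y)).filter
      fun z => ∃ g ∈ T, c z.2 z.1 = c z.2 g ∧ z.1 ≠ g).card ≤ 2 * D * T.card := by
  induction hn : T.card generalizing T with
  | zero => rw [Finset.card_eq_zero.1 hn]; simp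
  | succ n ih =>
    obtain ⟨f, hf, R, hR, hu⟩ := H T subset_rfl (Finset.card_pos.1 (by omega))
    have hT' : (T.erase f).card = n := by rw [Finset.card_erase_of_mem hf, hn]; rfl
    have ih' := ih (T.erase f) (fun T' h => H T' (h.trans (Finset.erase_subset _ _))) hT'
    set B' := ((T.erase f) ×ˢ (Finset.univ : Finset Y)).filter
      fun z => ∃ g ∈ T.erase f, c z.2 z.1 = c z.2 g ∧ z.1 ≠ g with hB'
    set N := ((T.erase f) ×ˢ R).filter fun z => c z.2 z.1 = c z.2 f ∧ z ∉ B' with hN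
    have hNcard : N.card ≤ R.card := by
      refine Finset.card_le_card_of_injOn Prod.snd ?_ ?_
      · intro z hz
        have hz := Finset.mem_coe.1 hz
        rw [hN, Finset.mem_filter, Finset.mem_product] at hz
        exact hz.1.2
      · rintro ⟨g, y⟩ hg ⟨g', y'⟩ hg' (rfl : y = y')
        have hg := Finset.mem_coe.1 hg
        have hg' := Finset.mem_coe.1 hg'
        rw [hN, Finset.mem_filter, Finset.mem_product] at hg hg'
        by_contra hne
        refine hg.2.2 ?_
        rw [hB', Finset.mem_filter, Finset.mem_product]
        exact ⟨⟨hg.1.1, Finset.mem_univ _⟩, g', hg'.1.1, hg.2.1.trans hg'.2.1.symm,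
          fun h => hne (by simpa using h)⟩
    have hsub : ((T ×ˢ (Finset.univ : Finset Y)).filter
        fun z => ∃ g ∈ T, c z.2 z.1 = c z.2 g ∧ z.1 ≠ g) ⊆ B' ∪ N ∪ ({f} ×ˢ R) := by
      rintro ⟨g, y⟩ hz
      rw [Finset.mem_filter, Finset.mem_product] at hz
      obtain ⟨⟨hg, -⟩, g', hg', hcc, hne⟩ := hz
      simp only at hg hcc hne
      rw [Finset.mem_union, Finset.mem_union]
      by_cases hgf : g = f
      · subst hgf
        refine Or.inr (Finset.mem_product.2 ⟨by simp, ?_⟩)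
        by_contra hy
        exact hne (hu y hy g' hg' hcc)
      left
      by_cases hb : (g, y) ∈ B'
      · exact Or.inl hb
      right
      have hgf' : g' = f := by
        by_contra h
        refine hb ?_
        rw [hB', Finset.mem_filter, Finset.mem_product]
        exact ⟨⟨Finset.mem_erase.2 ⟨hgf, hg⟩, Finset.mem_univ _⟩, g',
          Finset.mem_erase.2 ⟨h, hg'⟩, hcc, hne⟩
      subst hgf'
      rw [hN, Finset.mem_filter, Finset.mem_product]
      refine ⟨⟨Finset.mem_erase.2 ⟨hgf, hg⟩, ?_⟩, hcc, hb⟩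
      by_contra hy
      exact hgf (hu y hy g hg hcc.symm).symm
    calc _ ≤ (B' ∪ N ∪ ({f} ×ˢ R)).card := Finset.card_le_card hsub
      _ ≤ B'.card + N.card + ({f} ×ˢ R).card :=
        (Finset.card_union_le _ _).trans (Nat.add_le_add_right (Finset.card_union_le _ _) _)
      _ ≤ 2 * D * n + D + D := by
        rw [Finset.card_product, Finset.card_singleton, one_mul]; omega
      _ = 2 * D * (n + 1) := by ring

/-- If more pairs `(f, y)` with `f ∈ L` exist than can collide, one of them is free of collisions.
-/
theorem exists_isolated {α Y Λ : Type*} [DecidableEq α] [Fintype Y] (c : Y → α → Λ) (D : ℕ)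
    (T L : Finset α) (hL : L ⊆ T)
    (H : ∀ T' ⊆ T, T'.Nonempty → ∃ f ∈ T', ∃ R : Finset Y, R.card ≤ D ∧
      ∀ y ∉ R, ∀ g ∈ T', c y f = c y g → f = g)
    (hcard : 2 * D * T.card < L.card * Fintype.card Y) :
    ∃ f ∈ L, ∃ y, ∀ g ∈ T, c y f = c y g → f = g := by
  classical
  by_contra hcon
  push Not at hcon
  have h1 := card_collisions_le c D T H
  have h2 : L ×ˢ (Finset.univ : Finset Y) ⊆ (T ×ˢ (Finset.univ : Finset Y)).filter
      fun z => ∃ g ∈ T, c z.2 z.1 = c z.2 g ∧ z.1 ≠ g := by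
    rintro ⟨f, y⟩ hf
    rw [Finset.mem_product] at hf
    exact Finset.mem_filter.2 ⟨Finset.mem_product.2 ⟨hL hf.1, hf.2⟩, hcon f hf.1 y⟩
  have h3 := Finset.card_le_card h2
  rw [Finset.card_product, Finset.card_univ] at h3
  omega

end Isolation

/-! ### The labels of a number -/

section Labels

open Polynomial

/-- The polynomial over `ZMod p` whose coefficients are the base `p` digits of `x`. -/
noncomputable def digitPoly (p x : ℕ) : (ZMod p)[X] :=
  Nat.ofDigits X (p.digits x)

/-- The polynomial `f(X + y)` with natural coefficients, where `f` has the base `p` digits of `x` as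
coefficients. Its `j`-th coefficient is the `j`-th Taylor coefficient of `f` at `y`. -/
noncomputable def shiftPoly (p y x : ℕ) : ℕ[X] :=
  Nat.ofDigits (X + C y) (p.digits x)

/-- The label of `x` at the point `y`: the first `σ` Taylor coefficients at `y` of the digit
polynomial of `x`, reduced modulo `p` and read as the base `p` digits of a single number below
`p ^ σ`. -/
noncomputable def label (p σ y x : ℕ) : ℕ :=
  ∑ j ∈ Finset.range σ, ((shiftPoly p y x).coeff j % p) * p ^ j

theorem map_ofDigits {R S : Type*} [Semiring R] [Semiring S] (φ : R →+* S) (b : R) (L : List ℕ) :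
    φ (Nat.ofDigits b L) = Nat.ofDigits (φ b) L := by
  induction L with
  | nil => simp [Nat.ofDigits]
  | cons a L ih => simp only [Nat.ofDigits_eq_foldr] at ih ⊢; simp [ih]

theorem coeff_ofDigits_X {R : Type*} [CommSemiring R] (L : List ℕ) (j : ℕ) :
    (Nat.ofDigits (X : R[X]) L).coeff j = ((L.getD j 0 : ℕ) : R) := by
  induction L generalizing j with
  | nil => simp [Nat.ofDigits]
  | cons a L ih =>
    have : Nat.ofDigits (X : R[X]) (a :: L) = (a : R[X]) + X * Nat.ofDigits X L := rfl
    rw [this, coeff_add]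
    cases j with
    | zero => simp
    | succ j => rw [coeff_X_mul, ih]; simp [coeff_natCast_ite]

theorem coeff_digitPoly {p : ℕ} (hp : 2 ≤ p) (x j : ℕ) :
    (digitPoly p x).coeff j = ((x / p ^ j : ℕ) : ZMod p) := by
  rw [digitPoly, coeff_ofDigits_X, Nat.getD_digits _ _ hp, ZMod.natCast_mod]

theorem natDegree_digitPoly_lt {p m x : ℕ} (hp : 2 ≤ p) (hm : 0 < m) (hx : x < p ^ m) :
    (digitPoly p x).natDegree < m := by
  rcases eq_or_ne (digitPoly p x) 0 with h0 | h0
  · rwa [h0, natDegree_zero]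
  refine (natDegree_lt_iff_degree_lt h0).2 ((degree_lt_iff_coeff_zero _ _).2 fun j hj => ?_)
  rw [coeff_digitPoly hp, Nat.div_eq_of_lt (hx.trans_le (Nat.pow_le_pow_right (by omega) hj)),
    Nat.cast_zero]

theorem digitPoly_injective {p : ℕ} (hp : 2 ≤ p) : Function.Injective (digitPoly p) := by
  intro x x' h
  have hdig : ∀ j, x / p ^ j % p = x' / p ^ j % p := fun j => by
    have := congrArg (fun q => q.coeff j) h
    simp only [coeff_digitPoly hp] at this
    exact (ZMod.natCast_eq_natCast_iff' _ _ _).1 this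
  clear h
  induction x using Nat.strong_induction_on generalizing x' with
  | _ x ih =>
    rcases Nat.eq_zero_or_pos x with rfl | hx
    · by_contra hne
      have hx' : 0 < x' := by omega
      have h1 := hdig (Nat.log p x')
      rw [Nat.zero_div, Nat.zero_mod] at h1
      have h2 : 0 < x' / p ^ Nat.log p x' :=
        Nat.div_pos (Nat.pow_log_le_self p (by omega)) (by positivity)
      have h3 : x' / p ^ Nat.log p x' < p := by
        rw [Nat.div_lt_iff_lt_mul (by positivity), mul_comm, ← pow_succ]
        exact Nat.lt_pow_succ_log_self hp x'
      rw [Nat.mod_eq_of_lt h3] at h1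
      omega
    · have h0 := hdig 0
      have h1 := ih (x / p) (Nat.div_lt_self hx hp) (x' := x' / p) fun j => by
        have := hdig (j + 1)
        rwa [pow_succ', ← Nat.div_div_eq_div_mul, ← Nat.div_div_eq_div_mul] at this
      simp only [pow_zero, Nat.div_one] at h0
      rw [← Nat.div_add_mod x p, ← Nat.div_add_mod x' p, h0, h1]

theorem map_shiftPoly (p y x : ℕ) :
    (shiftPoly p y x).map (Nat.castRingHom (ZMod p)) = taylor (y : ZMod p) (digitPoly p x) := by
  have h := map_ofDigits (taylorAlgHom (y : ZMod p)).toRingHom X (p.digits x)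
  rw [shiftPoly, ← coe_mapRingHom, map_ofDigits]
  change taylor (y : ZMod p) (Nat.ofDigits X (p.digits x)) =
    Nat.ofDigits (taylor (y : ZMod p) X) (p.digits x) at h
  rw [digitPoly, h, taylor_X]
  simp

theorem eval_shiftPoly (p y x b : ℕ) :
    (shiftPoly p y x).eval b = Nat.ofDigits (b + y) (p.digits x) := by
  rw [shiftPoly, ← coe_evalRingHom, map_ofDigits]
  simp

theorem coeff_shiftPoly_le {p y x j : ℕ} (hy : y < p) : (shiftPoly p y x).coeff j ≤ x := by
  have h1 : (shiftPoly p y x).coeff j ≤ (shiftPoly p y x).eval 1 := by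
    rw [eval_eq_sum_range]
    simp only [one_pow, mul_one]
    by_cases hj : j ≤ (shiftPoly p y x).natDegree
    · exact Finset.single_le_sum (f := fun j => (shiftPoly p y x).coeff j) (fun _ _ => Nat.zero_le _)
        (Finset.mem_range.2 (by omega))
    · rw [coeff_eq_zero_of_natDegree_lt (by omega)]; exact Nat.zero_le _
  refine h1.trans ?_
  rw [eval_shiftPoly]
  exact (Nat.ofDigits_monotone _ (by omega)).trans (Nat.ofDigits_digits p x).le

theorem sum_mul_pow_lt {p : ℕ} (a : ℕ → ℕ) (ha : ∀ j, a j < p) (σ : ℕ) :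
    ∑ j ∈ Finset.range σ, a j * p ^ j < p ^ σ := by
  induction σ with
  | zero => simp
  | succ σ ih =>
    rw [Finset.sum_range_succ, pow_succ']
    have := Nat.mul_le_mul_right (p ^ σ) (ha σ)
    rw [Nat.succ_eq_add_one, add_mul] at this
    omega

theorem eq_of_sum_mul_pow_eq {p : ℕ} (a b : ℕ → ℕ) (ha : ∀ j, a j < p) (hb : ∀ j, b j < p) (σ : ℕ)
    (h : ∑ j ∈ Finset.range σ, a j * p ^ j = ∑ j ∈ Finset.range σ, b j * p ^ j) :
    ∀ j < σ, a j = b j := by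
  induction σ with
  | zero => simp
  | succ σ ih =>
    have hp : 0 < p := (Nat.zero_le _).trans_lt (ha 0)
    have h1 := sum_mul_pow_lt a ha σ
    have h2 := sum_mul_pow_lt b hb σ
    rw [Finset.sum_range_succ, Finset.sum_range_succ] at h
    have h3 : a σ = b σ := by
      have := congrArg (· / p ^ σ) h
      simpa [Nat.add_mul_div_right _ _ (pow_pos hp σ), Nat.div_eq_of_lt h1, Nat.div_eq_of_lt h2]
        using this
    rw [h3] at h
    intro j hj
    rcases Nat.lt_succ_iff_lt_or_eq.1 hj with hj | rfl
    · exact ih (by omega) j hj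
    · exact h3

theorem label_lt {p : ℕ} (hp : 0 < p) (σ y x : ℕ) : label p σ y x < p ^ σ :=
  sum_mul_pow_lt _ (fun _ => Nat.mod_lt _ hp) σ

theorem pow_dvd_digitPoly_sub {p σ y x x' : ℕ} (hp : 0 < p)
    (h : label p σ y x = label p σ y x') :
    (X - C (y : ZMod p)) ^ σ ∣ digitPoly p x - digitPoly p x' := by
  have h1 := eq_of_sum_mul_pow_eq _ _ (fun _ => Nat.mod_lt _ hp) (fun _ => Nat.mod_lt _ hp) σ h
  have h2 : X ^ σ ∣ taylor (y : ZMod p) (digitPoly p x - digitPoly p x') := by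
    rw [X_pow_dvd_iff]
    intro j hj
    rw [map_sub, ← map_shiftPoly, ← map_shiftPoly, coeff_sub, coeff_map, coeff_map, sub_eq_zero]
    exact (ZMod.natCast_eq_natCast_iff' _ _ _).2 (h1 j hj)
  obtain ⟨q, hq⟩ := h2
  refine ⟨taylor (-(y : ZMod p)) q, ?_⟩
  have h3 := congrArg (taylor (-(y : ZMod p))) hq
  rw [taylor_taylor, neg_add_cancel, taylor_zero, taylor_mul, taylor_X_pow, C_neg,
    ← sub_eq_add_neg] at h3
  exact h3

/-- Two numbers in the same block `[q p^σ, (q+1) p^σ)` have digit polynomials whose difference has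
degree less than `σ`, so equal labels force equality. -/
theorem eq_of_label_eq_of_div_eq {p : ℕ} [Fact p.Prime] {σ y x x' : ℕ}
    (h : label p σ y x = label p σ y x') (hd : x / p ^ σ = x' / p ^ σ) : x = x' := by
  have hp := (Fact.out : p.Prime).two_le
  have h1 := pow_dvd_digitPoly_sub (by omega) h
  refine digitPoly_injective hp (sub_eq_zero.1 ?_)
  by_contra hne
  have h2 := natDegree_le_of_dvd h1 hne
  rw [natDegree_pow, natDegree_X_sub_C, mul_one, ← not_lt] at h2
  refine h2 ?_
  rw [natDegree_lt_iff_degree_lt hne, degree_lt_iff_coeff_zero]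
  intro j hj
  obtain ⟨i, rfl⟩ := Nat.exists_eq_add_of_le hj
  rw [coeff_sub, coeff_digitPoly hp, coeff_digitPoly hp, pow_add, ← Nat.div_div_eq_div_mul,
    ← Nat.div_div_eq_div_mul, hd, sub_self]

/-- Each complete block `[q p^σ, (q+1) p^σ)` contains an element of each label. -/
theorem exists_label_eq {p : ℕ} [Fact p.Prime] {σ : ℕ} (y q l : ℕ) (hl : l < p ^ σ) :
    ∃ x, x / p ^ σ = q ∧ label p σ y x = l := by
  have hp := (Fact.out : p.Prime).pos
  have hN : 0 < p ^ σ := pow_pos hp σ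
  let φ : Fin (p ^ σ) → Fin (p ^ σ) := fun r => ⟨label p σ y (q * p ^ σ + r), label_lt hp _ _ _⟩
  have hdiv : ∀ r : Fin (p ^ σ), (q * p ^ σ + r) / p ^ σ = q := fun r => by
    rw [mul_comm, Nat.mul_add_div hN, Nat.div_eq_of_lt r.2, add_zero]
  have hφ : Function.Injective φ := by
    intro r r' h
    have := eq_of_label_eq_of_div_eq (Fin.mk.inj h) ((hdiv r).trans (hdiv r').symm)
    exact Fin.ext (by omega)
  obtain ⟨r, hr⟩ := (Finite.surjective_of_injective hφ) ⟨l, hl⟩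
  exact ⟨_, hdiv r, Fin.mk.inj hr⟩

/-- For the field size `p > 8 * e * σ * h * m` and the degree bound `h` with `h ^ σ > 32 * e * k`,
some element of `L` has at some point `y` a label that no other element of `L ∪ S` has. With
`a = ⌊p / (8 * e)⌋` there are at most `2 * (a + σ * h * m) * 2 * k` colliding pairs, which is less
than the number `p * |L|` of all pairs from `L`. -/
theorem exists_isolating_label {p : ℕ} [Fact p.Prime] {n k e σ h m : ℕ} (he : 0 < e) (hσ : 0 < σ)
    (hh : 0 < h) (hm : 0 < m) (hn : n ≤ 2 ^ m) (hw : 32 * e * k < h ^ σ) (hp : 8 * e * σ * h * m < p)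
    {L S : Finset ℕ} (hL : k < e * L.card) (hLk : L.card ≤ k) (hSk : S.card ≤ k)
    (hLn : ∀ x ∈ L, x < n) (hSn : ∀ x ∈ S, x < n) :
    ∃ x ∈ L, ∃ y < p, ∀ z ∈ L ∪ S, label p σ y x = label p σ y z → x = z := by
  classical
  have hp2 := (Fact.out : p.Prime).two_le
  -- the degree in `X`; large enough for `a * h ^ σ > p * 2 * k`, small enough for `4 * e * a ≤ p / 2`
  set a := p / (8 * e) with ha
  set s := σ * h * m with hs
  have hspos : 0 < s := by positivity
  have h8 : 8 * e * s < p := by rw [hs]; calc _ = 8 * e * σ * h * m := by ring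
    _ < p := hp
  have h8e : 8 * e ≤ p := le_trans (Nat.le_mul_of_pos_right _ hspos) h8.le
  have ha1 : 8 * e * a ≤ p := Nat.mul_div_le p (8 * e)
  have ha2 : p < 8 * e * (a + 1) := by
    have := Nat.lt_div_mul_add (a := p) (b := 8 * e) (by omega); rw [ha]; linarith
  have hapos : 0 < a := Nat.div_pos h8e (by omega)
  have ha3 : p ≤ 16 * e * a := by nlinarith
  have hsp : s ≤ p := le_trans (Nat.le_mul_of_pos_left _ (by omega)) h8.le
  have hmp : m ≤ p := le_trans (by rw [hs]; exact Nat.le_mul_of_pos_left _ (by positivity)) hsp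
  have hhp : h ≤ p :=
    le_trans (by rw [hs]; nlinarith [Nat.mul_le_mul_left h (mul_pos hσ hm)]) hsp
  have hD : a + s ≤ p := by nlinarith
  have hT : (L ∪ S).card ≤ 2 * k := (Finset.card_union_le _ _).trans (by omega)
  have hTn : ∀ x ∈ L ∪ S, x < n := fun x hx => (Finset.mem_union.1 hx).elim (hLn x) (hSn x)
  have hk : 0 < k := by
    rcases Nat.eq_zero_or_pos k with rfl | hk
    · have : L.card = 0 := by omega
      rw [this] at hL; omega
    · exact hk
  have hbox : p * (2 * k) < a * h ^ σ := by
    have h1 : 16 * e * (p * (2 * k)) < 16 * e * (a * h ^ σ) := by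
      calc 16 * e * (p * (2 * k)) = p * (32 * e * k) := by ring
        _ < p * h ^ σ := Nat.mul_lt_mul_of_pos_left hw (by omega)
        _ ≤ 16 * e * a * h ^ σ := Nat.mul_le_mul_right _ ha3
        _ = _ := by ring
    exact lt_of_mul_lt_mul_left h1 (Nat.zero_le _)
  suffices h : ∃ x ∈ L, ∃ y : ZMod p, ∀ z ∈ L ∪ S, label p σ y.val x = label p σ y.val z → x = z by
    obtain ⟨x, hx, y, hy⟩ := h
    exact ⟨x, hx, y.val, y.val_lt, hy⟩
  refine exists_isolated (Y := ZMod p) (fun y x => label p σ y.val x) (a + s)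
    (L ∪ S) L Finset.subset_union_left (fun T' hT' hne => ?_) ?_
  · have hinj := digitPoly_injective hp2
    have hcardT : (T'.image (digitPoly p)).card ≤ 2 * k := by
      rw [Finset.card_image_of_injective _ hinj]
      exact (Finset.card_le_card hT').trans hT
    obtain ⟨f, hf, R, hR, hu⟩ := exists_mem_card_collisions_le (F := ZMod p) (p := p) (ZMod.card p)
      (T := T'.image (digitPoly p)) hapos hmp hhp (hs ▸ hD) (hne.image _) (fun f hf => by
        obtain ⟨x, hx, rfl⟩ := Finset.mem_image.1 hf
        exact natDegree_digitPoly_lt hp2 hm ((hTn x (hT' hx)).trans_le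
          (hn.trans (Nat.pow_le_pow_left hp2 m))))
      (lt_of_le_of_lt (Nat.mul_le_mul_left p hcardT) hbox)
    obtain ⟨x, hx, rfl⟩ := Finset.mem_image.1 hf
    refine ⟨x, hx, R, hR, fun y hy z hz hl => hinj (hu y hy _ (Finset.mem_image_of_mem _ hz) ?_)⟩
    have := pow_dvd_digitPoly_sub (by omega) hl
    rwa [ZMod.natCast_zmod_val] at this
  · rw [ZMod.card]
    have h1 : e * (2 * (a + s) * (L ∪ S).card) < e * (L.card * p) := by
      calc e * (2 * (a + s) * (L ∪ S).card) ≤ e * (2 * (a + s) * (2 * k)) := by gcongr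
        _ = (4 * e * a + 4 * e * s) * k := by ring
        _ ≤ p * k := Nat.mul_le_mul_right _ (by nlinarith)
        _ < p * (e * L.card) := Nat.mul_lt_mul_of_pos_left hL (by omega)
        _ = _ := by ring
    exact lt_of_mul_lt_mul_left h1 (Nat.zero_le _)

/-- Together with `eval_div_eq_eval_divX`: the coefficients of `P` are the base `n` digits of `P(n)`
as long as they are less than `n`. -/
theorem eval_mod_eq_coeff_zero {n : ℕ} {P : ℕ[X]} (hP : P.coeff 0 < n) : P.eval n % n = P.coeff 0 := by
  conv_lhs => rw [← divX_mul_X_add P]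
  simp [Nat.mod_eq_of_lt hP]

theorem eval_div_eq_eval_divX {n : ℕ} {P : ℕ[X]} (hP : P.coeff 0 < n) :
    P.eval n / n = P.divX.eval n := by
  conv_lhs => rw [← divX_mul_X_add P]
  simp [Nat.add_div_of_dvd_right, Nat.div_eq_of_lt hP, Nat.mul_div_cancel _ (Nat.zero_lt_of_lt hP)]

theorem coeff_iterate_divX (P : ℕ[X]) (i j : ℕ) : (divX^[i] P).coeff j = P.coeff (j + i) := by
  induction i generalizing P with
  | zero => rfl
  | succ i ih => rw [Function.iterate_succ_apply, ih, coeff_divX]; congr 1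

end Labels

/-! ### Timed correctness statements for the random access machine -/

namespace LogRAM

instance : Add Expr := ⟨Expr.op Op.add⟩
instance : Sub Expr := ⟨Expr.op Op.sub⟩
instance : Mul Expr := ⟨Expr.op Op.mul⟩
instance : Div Expr := ⟨Expr.op Op.div⟩
instance : Mod Expr := ⟨Expr.op Op.mod⟩

section Eval
variable (s : State) (x y : Expr)

@[simp] theorem Expr.eval_lit (c : ℕ) : (Expr.lit c).eval s = c := rfl
@[simp] theorem Expr.eval_reg (i : ℕ) : (Expr.reg i).eval s = s.reg i := rfl
@[simp] theorem Expr.eval_load : (Expr.load x).eval s = s.mem (x.eval s) := rfl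
@[simp] theorem Expr.eval_add : (x + y).eval s = x.eval s + y.eval s := rfl
@[simp] theorem Expr.eval_sub : (x - y).eval s = x.eval s - y.eval s := rfl
@[simp] theorem Expr.eval_mul : (x * y).eval s = x.eval s * y.eval s := rfl
@[simp] theorem Expr.eval_div : (x / y).eval s = x.eval s / y.eval s := rfl
@[simp] theorem Expr.eval_mod : (x % y).eval s = x.eval s % y.eval s := rfl
theorem Expr.eval_lt_ne_zero :
    (Expr.op Op.lt x y).eval s ≠ 0 ↔ x.eval s < y.eval s := by
  simp [Expr.eval, Op.eval]
theorem Expr.eval_lt_eq_zero :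
    (Expr.op Op.lt x y).eval s = 0 ↔ y.eval s ≤ x.eval s := by
  simp [Expr.eval, Op.eval]

end Eval

/-- A bound for the bit length of the value of an expression, in units of `W + 1`, in a state in
which all stored numbers have at most `W` bits. A literal is bounded by its value instead of its bit
length, so that the weights of concrete expressions evaluate to numerals. -/
def Expr.valueWeight : Expr → ℕ
  | lit c => c
  | reg _ => 1
  | load _ => 1
  | op _ x y => x.valueWeight + y.valueWeight + 1

/-- A bound for the cost of an expression, in the same units as `Expr.valueWeight`. -/
def Expr.costWeight : Expr → ℕ
  | lit c => 1 + c
  | reg _ => 1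
  | load a => a.costWeight + (a.valueWeight + 1)
  | op _ x y => x.costWeight + y.costWeight +
      (1 + x.valueWeight + y.valueWeight + (x.valueWeight + y.valueWeight + 1))

section Weights
variable (x y : Expr)

@[simp] theorem Expr.valueWeight_lit (c : ℕ) : (Expr.lit c).valueWeight = c := rfl
@[simp] theorem Expr.valueWeight_reg (i : ℕ) : (Expr.reg i).valueWeight = 1 := rfl
@[simp] theorem Expr.valueWeight_load : (Expr.load x).valueWeight = 1 := rfl
@[simp] theorem Expr.valueWeight_add : (x + y).valueWeight = x.valueWeight + y.valueWeight + 1 := rfl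
@[simp] theorem Expr.valueWeight_sub : (x - y).valueWeight = x.valueWeight + y.valueWeight + 1 := rfl
@[simp] theorem Expr.valueWeight_mul : (x * y).valueWeight = x.valueWeight + y.valueWeight + 1 := rfl
@[simp] theorem Expr.valueWeight_div : (x / y).valueWeight = x.valueWeight + y.valueWeight + 1 := rfl
@[simp] theorem Expr.valueWeight_mod : (x % y).valueWeight = x.valueWeight + y.valueWeight + 1 := rfl
@[simp] theorem Expr.valueWeight_op (o : Op) :
    (Expr.op o x y).valueWeight = x.valueWeight + y.valueWeight + 1 := rfl
@[simp] theorem Expr.costWeight_lit (c : ℕ) : (Expr.lit c).costWeight = 1 + c := rfl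
@[simp] theorem Expr.costWeight_reg (i : ℕ) : (Expr.reg i).costWeight = 1 := rfl
@[simp] theorem Expr.costWeight_load :
    (Expr.load x).costWeight = x.costWeight + (x.valueWeight + 1) := rfl
@[simp] theorem Expr.costWeight_op (o : Op) : (Expr.op o x y).costWeight =
    x.costWeight + y.costWeight +
      (1 + x.valueWeight + y.valueWeight + (x.valueWeight + y.valueWeight + 1)) := rfl
@[simp] theorem Expr.costWeight_add : (x + y).costWeight = x.costWeight + y.costWeight +
      (1 + x.valueWeight + y.valueWeight + (x.valueWeight + y.valueWeight + 1)) := rfl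
@[simp] theorem Expr.costWeight_sub : (x - y).costWeight = x.costWeight + y.costWeight +
      (1 + x.valueWeight + y.valueWeight + (x.valueWeight + y.valueWeight + 1)) := rfl
@[simp] theorem Expr.costWeight_mul : (x * y).costWeight = x.costWeight + y.costWeight +
      (1 + x.valueWeight + y.valueWeight + (x.valueWeight + y.valueWeight + 1)) := rfl
@[simp] theorem Expr.costWeight_div : (x / y).costWeight = x.costWeight + y.costWeight +
      (1 + x.valueWeight + y.valueWeight + (x.valueWeight + y.valueWeight + 1)) := rfl
@[simp] theorem Expr.costWeight_mod : (x % y).costWeight = x.costWeight + y.costWeight +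
      (1 + x.valueWeight + y.valueWeight + (x.valueWeight + y.valueWeight + 1)) := rfl

end Weights

/-- All numbers in the registers and in the memory have at most `W` bits. -/
def State.Small (W : ℕ) (s : State) : Prop :=
  (∀ i, s.reg i < 2 ^ W) ∧ ∀ a, s.mem a < 2 ^ W

theorem size_add_one_le (a b : ℕ) : (a + b).size ≤ a.size + b.size + 1 := by
  rw [Nat.size_le]
  have h1 := Nat.lt_size_self a
  have h2 := Nat.lt_size_self b
  have h3 : 2 ^ a.size ≤ 2 ^ (a.size + b.size) := Nat.pow_le_pow_right (by norm_num) (by omega)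
  have h4 : 2 ^ b.size ≤ 2 ^ (a.size + b.size) := Nat.pow_le_pow_right (by norm_num) (by omega)
  rw [pow_succ]
  omega

theorem size_mul_le (a b : ℕ) : (a * b).size ≤ a.size + b.size := by
  rw [Nat.size_le, pow_add]
  exact Nat.mul_lt_mul'' (Nat.lt_size_self a) (Nat.lt_size_self b)

theorem Op.size_eval_le (o : Op) (a b : ℕ) : (o.eval a b).size ≤ a.size + b.size + 1 := by
  have hx : ∀ c, c ≤ a → c.size ≤ a.size + b.size + 1 := fun c h =>
    (Nat.size_le_size h).trans (by omega)
  have hb : ∀ P : Prop, ∀ [Decidable P], (if P then 1 else 0 : ℕ).size ≤ a.size + b.size + 1 := by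
    intro P _
    split_ifs <;> simp
  have h1 : a < 2 ^ (a.size + b.size) :=
    (Nat.lt_size_self a).trans_le (Nat.pow_le_pow_right (by norm_num) (by omega))
  have h2 : b < 2 ^ (a.size + b.size) :=
    (Nat.lt_size_self b).trans_le (Nat.pow_le_pow_right (by norm_num) (by omega))
  cases o with
  | add => exact size_add_one_le a b
  | sub => exact hx _ (Nat.sub_le _ _)
  | mul => exact (size_mul_le a b).trans (by omega)
  | div => exact hx _ (Nat.div_le_self _ _)
  | mod => exact hx _ (Nat.mod_le _ _)
  | and => exact hx _ Nat.and_le_left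
  | or => exact (Nat.size_le.2 (Nat.or_lt_two_pow h1 h2)).trans (by omega)
  | xor => exact (Nat.size_le.2 (Nat.xor_lt_two_pow h1 h2)).trans (by omega)
  | lt => exact hb _
  | eq => exact hb _

theorem size_le_self (c : ℕ) : c.size ≤ c := Nat.size_le.2 Nat.lt_two_pow_self

theorem Expr.size_eval_le {W : ℕ} {s : State} (hs : s.Small W) (e : Expr) :
    (e.eval s).size ≤ e.valueWeight * (W + 1) := by
  induction e with
  | lit c => exact (size_le_self c).trans (Nat.le_mul_of_pos_right _ (by omega))
  | reg i => exact (Nat.size_le.2 (hs.1 i)).trans (by simp [valueWeight])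
  | load a => exact (Nat.size_le.2 (hs.2 _)).trans (by simp [valueWeight])
  | op o x y hx hy =>
    refine (Op.size_eval_le o _ _).trans ?_
    rw [valueWeight, add_mul, add_mul]
    omega

theorem Expr.cost_le {W : ℕ} {s : State} (hs : s.Small W) (e : Expr) :
    e.cost s ≤ e.costWeight * (W + 1) := by
  induction e with
  | lit c =>
    exact (Nat.add_le_add_left (size_le_self c) 1).trans (Nat.le_mul_of_pos_right _ (by omega))
  | reg i =>
    have := Nat.size_le.2 (hs.1 i)
    simp only [cost, costWeight]; omega
  | load a ha =>
    have h1 := Nat.size_le.2 (hs.2 (a.eval s))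
    have h2 := size_eval_le hs a
    simp only [cost, costWeight, add_mul] at *; omega
  | op o x y hx hy =>
    have h1 := size_eval_le hs x
    have h2 := size_eval_le hs y
    have h3 := Op.size_eval_le o (x.eval s) (y.eval s)
    simp only [cost, costWeight, add_mul] at *; omega

/-- Started in the state `s`, the program `p` halts in a state that satisfies `R`, within time
`T * (W + 1)`, provided that all stored numbers have at most `W` bits in `s`; this bound on the
stored numbers then also holds at the end. -/
def Does (W : ℕ) (p : Prog) (s : State) (T : ℕ) (R : State → Prop) : Prop :=
  s.Small W → ∃ t s', Runs p s t s' ∧ t ≤ T * (W + 1) ∧ s'.Small W ∧ R s'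

/-- The state in which register `i` is overwritten by `v`. -/
def State.set (s : State) (i v : ℕ) : State := { s with reg := Function.update s.reg i v }

@[simp] theorem State.reg_set (s : State) (i v j : ℕ) :
    (s.set i v).reg j = if j = i then v else s.reg j := by
  simp [State.set, Function.update_apply]
@[simp] theorem State.mem_set (s : State) (i v : ℕ) : (s.set i v).mem = s.mem := rfl
@[simp] theorem State.out_set (s : State) (i v : ℕ) : (s.set i v).out = s.out := rfl

variable {W : ℕ} {s : State} {T T' T₁ T₂ : ℕ} {R R' : State → Prop} {p q : Prog} {c e : Expr}

theorem State.Small.set (hs : s.Small W) {i v : ℕ} (hv : v < 2 ^ W) : (s.set i v).Small W := by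
  refine ⟨fun j => ?_, hs.2⟩
  rw [State.reg_set]
  split_ifs
  · exact hv
  · exact hs.1 j

theorem Does.mono (h : Does W p s T R) (hT : T ≤ T') (hR : ∀ s', R s' → R' s') :
    Does W p s T' R' := by
  intro hs
  obtain ⟨t, s', h1, h2, h3, h4⟩ := h hs
  exact ⟨t, s', h1, h2.trans (Nat.mul_le_mul_right _ hT), h3, hR _ h4⟩

theorem Does.seq (hp : Does W p s T₁ R') (hq : ∀ s', R' s' → Does W q s' T₂ R) :
    Does W (p.seq q) s (T₁ + T₂) R := by
  intro hs
  obtain ⟨t, s', h1, h2, h3, h4⟩ := hp hs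
  obtain ⟨t', s'', h1', h2', h3', h4'⟩ := hq s' h4 h3
  exact ⟨t + t', s'', h1.seq h1', by rw [add_mul]; omega, h3', h4'⟩

theorem Does.assign {i : ℕ} (hv : e.eval s < 2 ^ W) (hR : R (s.set i (e.eval s))) :
    Does W (Prog.assign i e) s (e.costWeight + 1) R := by
  intro hs
  refine ⟨_, _, Runs.assign i e s, ?_, hs.set hv, hR⟩
  have := e.cost_le hs
  rw [add_mul]; omega

theorem Does.assign_seq {i : ℕ} (hv : e.eval s < 2 ^ W) (hq : Does W q (s.set i (e.eval s)) T R) :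
    Does W ((Prog.assign i e).seq q) s (e.costWeight + 1 + T) R :=
  Does.seq (R' := fun s' => s' = s.set i (e.eval s)) (Does.assign hv rfl) fun _ h => h ▸ hq

theorem Does.nop (hR : R s) : Does W Prog.nop s 1 R :=
  fun hs => ⟨_, _, Runs.nop s, by omega, hs, hR⟩

theorem Does.store (hv : e.eval s < 2 ^ W)
    (hR : R { s with mem := Function.update s.mem (c.eval s) (e.eval s) }) :
    Does W (Prog.store c e) s (c.costWeight + e.costWeight + 1) R := by
  intro hs
  refine ⟨_, _, Runs.store c e s, ?_, ⟨hs.1, fun a => ?_⟩, hR⟩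
  · have h1 := e.cost_le hs
    have h2 := c.cost_le hs
    rw [add_mul, add_mul]; omega
  · simp only [Function.update_apply]
    split_ifs
    · exact hv
    · exact hs.2 a

theorem Does.write (hR : R { s with out := s.out ++ [e.eval s] }) :
    Does W (Prog.write e) s (e.costWeight + 1) R := by
  intro hs
  refine ⟨_, _, Runs.write e s, ?_, hs, hR⟩
  have := e.cost_le hs
  rw [add_mul]; omega

theorem Does.ite (hp : c.eval s ≠ 0 → Does W p s T R) (hq : c.eval s = 0 → Does W q s T R) :
    Does W (Prog.ite c p q) s (c.costWeight + 1 + T) R := by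
  intro hs
  have hc := c.cost_le hs
  by_cases h : c.eval s = 0
  · obtain ⟨t, s', h1, h2, h3, h4⟩ := hq h hs
    exact ⟨_, s', Runs.ite_false h h1, by rw [add_mul, add_mul]; omega, h3, h4⟩
  · obtain ⟨t, s', h1, h2, h3, h4⟩ := hp h hs
    exact ⟨_, s', Runs.ite_true h h1, by rw [add_mul, add_mul]; omega, h3, h4⟩

/-- The rule for loops, with an invariant `I` and a decreasing measure `μ` that is at most `M` at
the start and hence bounds the number of rounds. -/
theorem Does.loop {I : State → Prop} {M : ℕ} (μ : State → ℕ) (hI : I s) (hM : μ s ≤ M)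
    (hbody : ∀ s, I s → c.eval s ≠ 0 → Does W p s T fun s' => I s' ∧ μ s' < μ s) :
    Does W (Prog.loop c p) s (M * (c.costWeight + 1 + T) + (c.costWeight + 1))
      fun s' => I s' ∧ c.eval s' = 0 := by
  induction M generalizing s with
  | zero =>
    intro hs
    have hc := c.cost_le hs
    have h : c.eval s = 0 := by
      by_contra h
      obtain ⟨_, _, _, _, _, _, h5⟩ := hbody s hI h hs
      omega
    exact ⟨_, s, Runs.loop_done h, by rw [add_mul, add_mul]; omega, hs, hI, h⟩
  | succ M ih =>
    intro hs
    have hc := c.cost_le hs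
    by_cases h : c.eval s = 0
    · refine ⟨_, s, Runs.loop_done h, ?_, hs, hI, h⟩
      rw [add_mul _ (c.costWeight + 1)]
      refine le_trans ?_ (Nat.le_add_left _ _)
      rw [add_mul]; omega
    · obtain ⟨t, s', h1, h2, h3, h4, h5⟩ := hbody s hI h hs
      obtain ⟨t', s'', h1', h2', h3', h4'⟩ := ih h4 (by omega) h3
      refine ⟨_, s'', Runs.loop_step h h1 h1', ?_, h3', h4'⟩
      calc c.cost s + 1 + t + t' ≤ c.costWeight * (W + 1) + 1 * (W + 1) + T * (W + 1) +
            (M * (c.costWeight + 1 + T) + (c.costWeight + 1)) * (W + 1) := by omega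
        _ = _ := by ring

/-- The states agree in the registers below `a`, in the memory and in the output. A program that
only uses registers from `a` on as scratch space preserves this relation. -/
def State.Agree (a : ℕ) (s s₀ : State) : Prop :=
  (∀ j < a, s.reg j = s₀.reg j) ∧ s.mem = s₀.mem ∧ s.out = s₀.out

theorem State.Agree.refl (a : ℕ) (s : State) : s.Agree a s := ⟨fun _ _ => rfl, rfl, rfl⟩

theorem State.Agree.trans {a b : ℕ} {s₁ s₂ s₃ : State} (h : s₁.Agree a s₂) (h' : s₂.Agree b s₃)
    (hab : b ≤ a) : s₁.Agree b s₃ :=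
  ⟨fun j hj => (h.1 j (hj.trans_le hab)).trans (h'.1 j hj), h.2.1.trans h'.2.1, h.2.2.trans h'.2.2⟩

theorem State.Agree.set {a i v : ℕ} {s₀ : State} (h : s.Agree a s₀) (hi : a ≤ i) :
    (s.set i v).Agree a s₀ :=
  ⟨fun j hj => by rw [State.reg_set, if_neg (by omega)]; exact h.1 j hj, h.2⟩

open LogRAM.Prog LogRAM.Expr

/-! ### Computing the parameters -/

/-- Register 3 receives the bit length of the number in register 0. -/
def sizeProg : Prog :=
  (assign 3 (lit 0)).seq <| (assign 4 (lit 1)).seq <|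
    loop (op Op.lt (reg 4) (reg 0 + lit 1)) <|
      (assign 4 (reg 4 * lit 2)).seq (assign 3 (reg 3 + lit 1))

theorem does_sizeProg {n : ℕ} (hW : 2 * n < 2 ^ W) (hn : 0 < n) (h0 : s.reg 0 = n) :
    Does W sizeProg s (50 * n.size + 50) fun s' => s'.Agree 3 s ∧ s'.reg 3 = n.size := by
  have hsz : n.size ≤ n := size_le_self n
  refine Does.mono (Does.assign_seq ?_ (Does.assign_seq ?_ (Does.loop (M := n.size)
    (I := fun s' => s'.Agree 3 s ∧ s'.reg 3 ≤ n.size ∧ s'.reg 4 = 2 ^ s'.reg 3)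
    (fun s' => n.size - s'.reg 3) ?_ ?_ fun s' hI hc =>
      Does.assign_seq ?_ (Does.assign ?_ ?_)))) ?_ ?_
  · simp
  · simp only [eval_lit]; omega
  · exact ⟨((State.Agree.refl 3 s).set (by simp)).set (by simp), by simp, by simp⟩
  · simp
  all_goals try
    obtain ⟨hag, h3, h4⟩ := hI
    have hn' : s'.reg 4 ≤ n := by
      have : s'.reg 4 < s.reg 0 + 1 := by
        simpa [hag.1, eval_lt_ne_zero] using hc
      omega
    have hlt : s'.reg 3 < n.size := Nat.lt_size.2 (h4 ▸ hn')
  · simp; omega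
  · simp; omega
  · refine ⟨⟨(hag.set (by simp)).set (by simp), ?_, ?_⟩, ?_⟩
    · simp; omega
    · simp [h4, pow_succ]
    · simp; omega
  · simp; omega
  · rintro s' ⟨⟨hag, h3, h4⟩, hc⟩
    refine ⟨hag, le_antisymm h3 (Nat.size_le.2 ?_)⟩
    have : ¬ s'.reg 4 < s.reg 0 + 1 := by simpa [hag.1, eval_lt_eq_zero] using hc
    omega

/-- Register 6 receives the least `σ` for which `β ^ σ ^ 2` is at least the number in register 0,
where `β` is in register 5, and register 9 receives `2 ^ σ`. Registers 7 and 8 hold `β ^ i ^ 2` and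
`β ^ (2 * i + 1)`. -/
def rootProg : Prog :=
  (assign 6 (lit 0)).seq <| (assign 7 (lit 1)).seq <| (assign 8 (reg 5)).seq <|
    (assign 9 (lit 1)).seq <|
    loop (op Op.lt (reg 7) (reg 0)) <|
      (assign 6 (reg 6 + lit 1)).seq <| (assign 7 (reg 7 * reg 8)).seq <|
      (assign 8 (reg 8 * reg 5 * reg 5)).seq (assign 9 (reg 9 * lit 2))

theorem does_rootProg {n β σ : ℕ} (hβ : 2 ≤ β) (hσ : n ≤ β ^ σ ^ 2)
    (hσ' : ∀ i < σ, β ^ i ^ 2 < n) (hW : β ^ σ ^ 2 < 2 ^ W) (hW' : β ^ (2 * σ + 1) < 2 ^ W)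
    (h0 : s.reg 0 = n) (h5 : s.reg 5 = β) :
    Does W rootProg s (100 * σ + 100) fun s' =>
      s'.Agree 6 s ∧ s'.reg 6 = σ ∧ s'.reg 9 = 2 ^ σ := by
  have hβσ : ∀ i ≤ 2 * σ + 1, β ^ i < 2 ^ W := fun i hi =>
    (Nat.pow_le_pow_right (by omega) hi).trans_lt hW'
  have h2σ : ∀ i ≤ 2 * σ + 1, 2 ^ i < 2 ^ W := fun i hi =>
    (Nat.pow_le_pow_left hβ i).trans_lt (hβσ i hi)
  refine Does.mono (Does.assign_seq ?_ (Does.assign_seq ?_ (Does.assign_seq ?_ (Does.assign_seq ?_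
    (Does.loop (M := σ) (I := fun s' => s'.Agree 6 s ∧ s'.reg 6 ≤ σ ∧
      s'.reg 7 = β ^ s'.reg 6 ^ 2 ∧ s'.reg 8 = β ^ (2 * s'.reg 6 + 1) ∧ s'.reg 9 = 2 ^ s'.reg 6)
    (fun s' => σ - s'.reg 6) ?_ ?_ fun s' hI hc =>
      Does.assign_seq ?_ (Does.assign_seq ?_ (Does.assign_seq ?_ (Does.assign ?_ ?_)))))))) ?_ ?_
  · simp
  · simpa using h2σ 0 (by omega)
  · simpa [h5] using hβσ 1 (by omega)
  · simpa using h2σ 0 (by omega)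
  · exact ⟨((((State.Agree.refl 6 s).set (by simp)).set (by simp)).set (by simp)).set (by simp),
      by simp, by simp, by simp [h5], by simp⟩
  · simp
  all_goals try
    obtain ⟨hag, h6, h7, h8, h9⟩ := hI
    have hlt : s'.reg 6 < σ := by
      by_contra hcon
      have h6' : s'.reg 6 = σ := by omega
      rw [eval_lt_ne_zero] at hc
      simp [hag.1, h0, h7, h6'] at hc
      omega
    have e7 : s'.reg 7 * s'.reg 8 = β ^ (s'.reg 6 + 1) ^ 2 := by
      rw [h7, h8, ← pow_add]; congr 1; ring
    have e8 : s'.reg 8 * β * β = β ^ (2 * (s'.reg 6 + 1) + 1) := by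
      rw [h8]; ring
  · have := Nat.lt_two_pow_self (n := σ)
    have := h2σ σ (by omega)
    simp; omega
  · simp only [eval_mul, eval_reg, State.reg_set]
    norm_num
    rw [e7]
    exact (Nat.pow_le_pow_right (by omega) (Nat.pow_le_pow_left (by omega) 2)).trans_lt hW
  · simp [hag.1, h5, e8]
    exact hβσ _ (by omega)
  · simp [h9]
    rw [← pow_succ]
    exact h2σ _ (by omega)
  · refine ⟨⟨(((hag.set (by simp)).set (by simp)).set (by simp)).set (by simp), ?_, ?_, ?_, ?_⟩, ?_⟩
    · simp; omega
    · simp [e7]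
    · simp [hag.1, h5, e8]
    · simp [h9, pow_succ]
    · simp; omega
  · simp; omega
  · rintro s' ⟨⟨hag, h6, h7, h8, h9⟩, hc⟩
    have h6' : s'.reg 6 = σ := by
      refine le_antisymm h6 (not_lt.1 fun hlt => ?_)
      have h1 := hσ' _ hlt
      rw [← h7] at h1
      simp [hag.1, h0, eval_lt_eq_zero] at hc
      omega
    exact ⟨hag, h6', by rw [h9, h6']⟩

/-- Register 10 receives `2 ^ c` for the least `c` with `32 * e * k < z ^ c`, where `k`, `e`, `z`
are in registers 1, 2, 9. -/
def boxProg : Prog :=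
  (assign 10 (lit 1)).seq <| (assign 11 (lit 1)).seq <|
    loop (op Op.lt (reg 11) (lit 32 * reg 2 * reg 1 + lit 1)) <|
      (assign 10 (reg 10 * lit 2)).seq (assign 11 (reg 11 * reg 9))

theorem does_boxProg {k e z c : ℕ} (hz : 2 ≤ z) (hc : 32 * e * k < z ^ c)
    (hc' : ∀ i < c, z ^ i ≤ 32 * e * k) (hW : z ^ c < 2 ^ W)
    (h1 : s.reg 1 = k) (h2 : s.reg 2 = e) (h9 : s.reg 9 = z) :
    Does W boxProg s (400 * c + 400) fun s' => s'.Agree 10 s ∧ s'.reg 10 = 2 ^ c := by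
  have hz' : ∀ i ≤ c, z ^ i < 2 ^ W := fun i hi =>
    (Nat.pow_le_pow_right (by omega) hi).trans_lt hW
  have h2' : ∀ i ≤ c, 2 ^ i < 2 ^ W := fun i hi => (Nat.pow_le_pow_left hz i).trans_lt (hz' i hi)
  refine Does.mono (Does.assign_seq ?_ (Does.assign_seq ?_ (Does.loop (M := c)
    (I := fun s' => s'.Agree 10 s ∧ ∃ i ≤ c, s'.reg 10 = 2 ^ i ∧ s'.reg 11 = z ^ i)
    (fun s' => c - Nat.log 2 (s'.reg 10)) ?_ ?_ fun s' hI hcond =>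
      Does.assign_seq ?_ (Does.assign ?_ ?_)))) ?_ ?_
  · simpa using h2' 0 (by omega)
  · simpa using h2' 0 (by omega)
  · exact ⟨((State.Agree.refl 10 s).set (by simp)).set (by simp), 0, by simp, by simp, by simp⟩
  · simp
  all_goals try
    obtain ⟨hag, i, hi, h10, h11⟩ := hI
    have hlt : i < c := by
      by_contra hcon
      have hi' : i = c := by omega
      simp [hag.1, h1, h2, h11, hi', eval_lt_ne_zero] at hcond
      omega
  · simp [h10]
    rw [← pow_succ]
    exact h2' _ (by omega)
  · simp [h11, hag.1, h9]
    rw [← pow_succ]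
    exact hz' _ (by omega)
  · refine ⟨⟨(hag.set (by simp)).set (by simp), i + 1, by omega, ?_, ?_⟩, ?_⟩
    · simp [h10, pow_succ]
    · simp [h11, hag.1, h9, pow_succ]
    · simp [h10, ← pow_succ, Nat.log_pow]; omega
  · simp; omega
  · rintro s' ⟨⟨hag, i, hi, h10, h11⟩, hcond⟩
    have hi' : i = c := by
      refine le_antisymm hi (not_lt.1 fun hlt => ?_)
      have h3 := hc' _ hlt
      simp [hag.1, h1, h2, h11, eval_lt_eq_zero] at hcond
      omega
    exact ⟨hag, by rw [h10, hi']⟩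

/-- Register 12 receives the least prime above `8 * e * σ * h * m`, found by trial division. -/
def primeProg : Prog :=
  (assign 12 (lit 8 * reg 2 * reg 6 * reg 10 * reg 3 + lit 1)).seq <| (assign 13 (lit 2)).seq <|
    loop (op Op.lt (reg 13) (reg 12)) <|
      ite (reg 12 % reg 13) (assign 13 (reg 13 + lit 1))
        ((assign 12 (reg 12 + lit 1)).seq (assign 13 (lit 2)))

theorem does_primeProg {P p : ℕ} (hP1 : 1 ≤ P) (hp : p.Prime) (hPp : P < p)
    (hmin : ∀ q, q.Prime → P < q → p ≤ q) (hW : p < 2 ^ W)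
    (hP : 8 * s.reg 2 * s.reg 6 * s.reg 10 * s.reg 3 = P) :
    Does W primeProg s (100 * p ^ 2 + 200) fun s' => s'.Agree 12 s ∧ s'.reg 12 = p := by
  have hp2 := hp.two_le
  refine Does.mono (Does.assign_seq ?_ (Does.assign_seq ?_ (Does.loop (M := p * (p + 1))
    (I := fun s' => s'.Agree 12 s ∧ P < s'.reg 12 ∧ s'.reg 12 ≤ p ∧ 2 ≤ s'.reg 13 ∧
      s'.reg 13 ≤ s'.reg 12 ∧ ∀ d, 2 ≤ d → d < s'.reg 13 → ¬ d ∣ s'.reg 12)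
    -- each new candidate restarts the divisor, which is paid for by the factor `p + 1`
    (fun s' => (p - s'.reg 12) * (p + 1) + (p - s'.reg 13)) ?_ ?_ fun s' hI hc =>
      Does.ite (T := 20) (fun h => Does.mono (Does.assign ?_ ?_) ?_ fun _ => id)
        (fun h => Does.mono (Does.assign_seq ?_ (Does.assign ?_ ?_)) ?_ fun _ => id)))) ?_ ?_
  · simp [hP]; omega
  · simp; omega
  · refine ⟨((State.Agree.refl 12 s).set (by simp)).set (by simp), ?_, ?_, ?_, ?_, ?_⟩
    · simp [hP]
    · simp [hP]; omega
    · simp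
    · simp [hP]; omega
    · simp; omega
  · simp [hP]
    have : p - (P + 1) ≤ p - 1 := by omega
    have h1 := Nat.mul_le_mul_right (p + 1) this
    have h2 : (p - 1) * (p + 1) + (p + 1) = p * (p + 1) := by
      obtain ⟨q, rfl⟩ : ∃ q, p = q + 1 := ⟨p - 1, by omega⟩
      simp; ring
    omega
  all_goals try
    obtain ⟨hag, h1, h2, h3, h4, h5⟩ := hI
    simp [eval_lt_ne_zero] at hc h
  · simp; omega
  · refine ⟨⟨hag.set (by simp), ?_, ?_, ?_, ?_, ?_⟩, ?_⟩
    · simpa using h1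
    · simpa using h2
    · simp; omega
    · simp; omega
    · simp only [State.reg_set]
      norm_num
      intro d hd2 hd hdvd
      rcases Nat.lt_succ_iff_lt_or_eq.1 (Nat.lt_succ_of_le hd) with hd | rfl
      · exact h5 d hd2 hd hdvd
      · exact h (Nat.mod_eq_zero_of_dvd hdvd)
    · simp; omega
  · simp
  all_goals try
    have hnp : ¬ (s'.reg 12).Prime := fun hpr => by
      rcases (Nat.dvd_prime hpr).1 (Nat.dvd_of_mod_eq_zero h) with h6 | h6 <;> omega
    have hlt : s'.reg 12 < p := lt_of_le_of_ne h2 fun h6 => hnp (h6 ▸ hp)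
  · simp; omega
  · simp; omega
  · refine ⟨⟨(hag.set (by simp)).set (by simp), ?_, ?_, ?_, ?_, ?_⟩, ?_⟩
    · simp; omega
    · simp; omega
    · simp
    · simp; omega
    · simp; omega
    · simp
      obtain ⟨q, hq⟩ : ∃ q, p - s'.reg 12 = q + 1 := ⟨p - s'.reg 12 - 1, by omega⟩
      rw [show p - (s'.reg 12 + 1) = q by omega, hq]
      have : (q + 1) * (p + 1) = q * (p + 1) + (p + 1) := by ring
      omega
  · simp
  · simp; nlinarith
  · rintro s' ⟨⟨hag, h1, h2, h3, h4, h5⟩, hc⟩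
    simp [eval_lt_eq_zero] at hc
    have heq : s'.reg 13 = s'.reg 12 := le_antisymm h4 hc
    refine ⟨hag, le_antisymm h2 (hmin _ ?_ h1)⟩
    exact Nat.prime_def_lt'.2 ⟨by omega, fun d hd2 hd => h5 d hd2 (by omega)⟩

/-- Register 14 receives `p ^ σ`, where `σ` and `p` are in registers 6 and 12. -/
def powProg : Prog :=
  (assign 14 (lit 1)).seq <| (assign 15 (reg 6)).seq <|
    loop (reg 15) ((assign 14 (reg 14 * reg 12)).seq (assign 15 (reg 15 - lit 1)))

theorem does_powProg {p σ : ℕ} (hp : 2 ≤ p) (hW : p ^ σ < 2 ^ W) (h6 : s.reg 6 = σ)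
    (h12 : s.reg 12 = p) :
    Does W powProg s (50 * σ + 50) fun s' => s'.Agree 14 s ∧ s'.reg 14 = p ^ σ := by
  have hpW : ∀ i ≤ σ, p ^ i < 2 ^ W := fun i hi =>
    (Nat.pow_le_pow_right (by omega) hi).trans_lt hW
  have hσW : σ < 2 ^ W := ((Nat.lt_two_pow_self).trans_le (Nat.pow_le_pow_left hp σ)).trans hW
  refine Does.mono (Does.assign_seq ?_ (Does.assign_seq ?_ (Does.loop (M := σ)
    (I := fun s' => s'.Agree 14 s ∧ s'.reg 15 ≤ σ ∧ s'.reg 14 = p ^ (σ - s'.reg 15))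
    (fun s' => s'.reg 15) ?_ ?_ fun s' hI hc =>
      Does.assign_seq ?_ (Does.assign ?_ ?_)))) ?_ ?_
  · simpa using hpW 0 (by omega)
  · simpa [h6] using hσW
  · exact ⟨((State.Agree.refl 14 s).set (by simp)).set (by simp), by simp [h6], by simp [h6]⟩
  · simp [h6]
  all_goals try
    obtain ⟨hag, h15, h14⟩ := hI
    have hpos : s'.reg 15 ≠ 0 := by simpa using hc
    have e14 : s'.reg 14 * p = p ^ (σ - (s'.reg 15 - 1)) := by
      rw [h14, ← pow_succ]; congr 1; omega
  · simp [hag.1, h12, e14]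
    exact hpW _ (by omega)
  · simp; omega
  · refine ⟨⟨(hag.set (by simp)).set (by simp), ?_, ?_⟩, ?_⟩
    · simp; omega
    · simp [hag.1, h12, e14]
    · simp; omega
  · simp; omega
  · rintro s' ⟨⟨hag, h15, h14⟩, hc⟩
    have : s'.reg 15 = 0 := by simpa using hc
    exact ⟨hag, by rw [h14, this, Nat.sub_zero]⟩

/-! ### Computing a label -/

/-- Register 21 receives the value at `n + y` of the polynomial whose coefficients are the base `p`
digits of `x`, where `n`, `p`, `y`, `x` are in registers 0, 12, 17, 18. -/
def shiftProg : Prog :=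
  (assign 19 (reg 18)).seq <| (assign 20 (lit 1)).seq <| (assign 21 (lit 0)).seq <|
    loop (reg 19) <|
      (assign 21 (reg 21 + reg 19 % reg 12 * reg 20)).seq <|
      (assign 20 (reg 20 * (reg 0 + reg 17))).seq (assign 19 (reg 19 / reg 12))

/-- The value computed is that of `shiftPoly p y x` at `n`; a single long number thus carries all
the Taylor coefficients of the digit polynomial at `y`. -/
theorem does_shiftProg {n p x y m : ℕ} (hp : 2 ≤ p) (hpn : p ≤ n) (hx : x < n)
    (hm : (p.digits x).length ≤ m) (hW : (n + y) ^ m < 2 ^ W) (hnW : n < 2 ^ W)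
    (h0 : s.reg 0 = n) (h12 : s.reg 12 = p) (h17 : s.reg 17 = y) (h18 : s.reg 18 = x) :
    Does W shiftProg s (100 * m + 100) fun s' => s'.Agree 19 s ∧
      s'.reg 21 = (shiftPoly p y x).eval n := by
  set b := n + y with hb
  have hbW : ∀ i ≤ m, b ^ i < 2 ^ W := fun i hi =>
    (Nat.pow_le_pow_right (by omega) hi).trans_lt hW
  have hA : Nat.ofDigits b (p.digits x) ≤ b ^ (p.digits x).length :=
    (Nat.ofDigits_lt_base_pow_length (by omega) fun d hd =>
      (Nat.digits_lt_base (by omega) hd).trans_le (by omega)).le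
  rw [eval_shiftPoly]
  refine Does.mono (Does.assign_seq ?_ (Does.assign_seq ?_ (Does.assign_seq ?_ (Does.loop (M := m)
    (I := fun s' => s'.Agree 19 s ∧ s'.reg 19 ≤ x ∧
      (∃ i, i + (p.digits (s'.reg 19)).length = (p.digits x).length ∧ s'.reg 20 = b ^ i) ∧
      s'.reg 21 + s'.reg 20 * Nat.ofDigits b (p.digits (s'.reg 19)) = Nat.ofDigits b (p.digits x))
    (fun s' => (p.digits (s'.reg 19)).length) ?_ ?_ fun s' hI hc =>
      Does.assign_seq ?_ (Does.assign_seq ?_ (Does.assign ?_ ?_)))))) ?_ ?_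
  · simp [h18]; omega
  · simpa using hbW 0 (by omega)
  · simp
  · exact ⟨(((State.Agree.refl 19 s).set (by simp)).set (by simp)).set (by simp), by simp [h18],
      ⟨0, by simp [h18], by simp⟩, by simp [h18]⟩
  · simpa [h18] using hm
  all_goals try
    obtain ⟨hag, h19, ⟨i, hi, h20⟩, h21⟩ := hI
    have hne : s'.reg 19 ≠ 0 := by simpa using hc
    have hdig := Nat.digits_eq_cons_digits_div (b := p) (by omega) hne
    rw [hdig] at h21 hi
    rw [Nat.ofDigits_cons] at h21
    rw [List.length_cons] at hi
    have hAW := hA.trans_lt (hbW _ hm)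
    have e21 : s'.reg 21 + s'.reg 19 % p * s'.reg 20 +
        s'.reg 20 * b * Nat.ofDigits b (p.digits (s'.reg 19 / p)) =
        Nat.ofDigits b (p.digits x) := by
      rw [← h21]; ring
  · simp [hag.1, h12]
    omega
  · simp [hag.1, h0, h17, ← hb, h20]
    rw [← pow_succ]
    exact hbW _ (by omega)
  · have := Nat.div_le_self (s'.reg 19) p
    simp [hag.1, h12]
    omega
  · refine ⟨⟨((hag.set (by simp)).set (by simp)).set (by simp), ?_, ⟨i + 1, ?_, ?_⟩, ?_⟩, ?_⟩
    · have := Nat.div_le_self (s'.reg 19) p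
      simp [hag.1, h12]
      omega
    · simp [hag.1, h12]
      omega
    · simp [hag.1, h0, h17, ← hb, h20, pow_succ]
    · simp [hag.1, h0, h12, h17, ← hb, e21]
    · simp only [State.reg_set, eval_div, eval_reg]
      norm_num
      rw [hag.1 12 (by norm_num), h12, hdig]
      simp
  · simp; omega
  · rintro s' ⟨⟨hag, h19, -, h21⟩, hc⟩
    have : s'.reg 19 = 0 := by simpa using hc
    rw [this] at h21
    exact ⟨hag, by simpa using h21⟩

/-- Register 24 receives the label whose Taylor coefficients are the base `n` digits of the number
in register 21. -/
def digitsProg : Prog :=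
  (assign 22 (reg 6)).seq <| (assign 23 (lit 1)).seq <| (assign 24 (lit 0)).seq <|
    loop (reg 22) <|
      (assign 24 (reg 24 + reg 21 % reg 0 % reg 12 * reg 23)).seq <|
      (assign 23 (reg 23 * reg 12)).seq <| (assign 21 (reg 21 / reg 0)).seq
      (assign 22 (reg 22 - lit 1))

theorem does_digitsProg {n p σ x y : ℕ} (hp : 2 ≤ p) (hx : x < n) (hy : y < p)
    (hW : p ^ σ < 2 ^ W)
    (h0 : s.reg 0 = n) (h6 : s.reg 6 = σ) (h12 : s.reg 12 = p)
    (h21 : s.reg 21 = (shiftPoly p y x).eval n) :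
    Does W digitsProg s (100 * σ + 100) fun s' => s'.Agree 19 s ∧ s'.reg 24 = label p σ y x := by
  have hpW : ∀ i ≤ σ, p ^ i < 2 ^ W := fun i hi =>
    (Nat.pow_le_pow_right (by omega) hi).trans_lt hW
  have hσW : σ < 2 ^ W := ((Nat.lt_two_pow_self).trans_le (Nat.pow_le_pow_left hp σ)).trans hW
  have hlab : ∀ i ≤ σ, label p i y x < 2 ^ W := fun i hi =>
    (label_lt (by omega) i y x).trans (hpW i hi)
  have hco : ∀ i, (Polynomial.divX^[i] (shiftPoly p y x)).coeff 0 < n := fun i => by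
    rw [coeff_iterate_divX]; exact (coeff_shiftPoly_le hy).trans_lt hx
  intro hs
  have hsmall := hs.1 21
  revert hs
  refine Does.mono (Does.assign_seq ?_ (Does.assign_seq ?_ (Does.assign_seq ?_ (Does.loop (M := σ)
    (I := fun s' => s'.Agree 19 s ∧ s'.reg 21 ≤ s.reg 21 ∧ ∃ i, i + s'.reg 22 = σ ∧
      s'.reg 21 = (Polynomial.divX^[i] (shiftPoly p y x)).eval n ∧
      s'.reg 23 = p ^ i ∧ s'.reg 24 = label p i y x)
    (fun s' => s'.reg 22) ?_ ?_ fun s' hI hc =>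
      Does.assign_seq ?_ (Does.assign_seq ?_ (Does.assign_seq ?_ (Does.assign ?_ ?_))))))) ?_ ?_
  · simpa [h6] using hσW
  · simpa using hpW 0 (by omega)
  · simp
  · exact ⟨(((State.Agree.refl 19 s).set (by simp)).set (by simp)).set (by simp), by simp,
      0, by simp [h6], by simp [h21], by simp, by simp [label]⟩
  · simp [h6]
  all_goals try
    obtain ⟨hag, hle, i, hi, e21, h23, h24⟩ := hI
    have hne : s'.reg 22 ≠ 0 := by simpa using hc
    have e24 : s'.reg 24 + s'.reg 21 % n % p * s'.reg 23 = label p (i + 1) y x := by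
      rw [h24, h23, e21, eval_mod_eq_coeff_zero (hco i), coeff_iterate_divX, zero_add, label, label,
        Finset.sum_range_succ]
    have hdle := Nat.div_le_self (s'.reg 21) n
  · simp [hag.1, h0, h12, e24]
    exact hlab _ (by omega)
  · simp [hag.1, h12, h23]
    rw [← pow_succ]
    exact hpW _ (by omega)
  · simp [hag.1, h0]
    omega
  · simp; omega
  · refine ⟨⟨(((hag.set (by simp)).set (by simp)).set (by simp)).set (by simp), ?_, i + 1,
      ?_, ?_, ?_, ?_⟩, ?_⟩
    · simp [hag.1, h0]; omega
    · simp; omega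
    · simp [hag.1, h0]
      rw [e21, eval_div_eq_eval_divX (hco i), ← Function.iterate_succ_apply' Polynomial.divX,
        Function.iterate_succ_apply]
    · simp [hag.1, h12, h23, pow_succ]
    · simp [hag.1, h0, h12, e24]
    · simp; omega
  · simp; omega
  · rintro s' ⟨⟨hag, -, i, hi, -, -, h24⟩, hc⟩
    have : s'.reg 22 = 0 := by simpa using hc
    have : i = σ := by omega
    exact ⟨hag, by rw [h24, this]⟩

/-! ### Sorting the elements by label and writing the sets -/

/-- The memory cell reserved for the element `x` at the point `y`. The sets have `Q` consecutive
cells each; within its set, `x` is placed according to the block of length `p ^ σ` that contains it.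
-/
noncomputable def cell (p σ Q y x : ℕ) : ℕ := (y * p ^ σ + label p σ y x) * Q + x / p ^ σ

/-- The memory holds `x' + 1` in the cell of each pair `(y', x')` that precedes `(y, x)` in the
lexicographic order, and zero elsewhere. -/
def Filled (p σ Q n : ℕ) (mem : ℕ → ℕ) (y x : ℕ) : Prop :=
  (∀ y' x', x' < n → (y' < y ∨ y' = y ∧ x' < x) → mem (cell p σ Q y' x') = x' + 1) ∧
  ∀ a, mem a ≠ 0 → ∃ y' x', x' < n ∧ (y' < y ∨ y' = y ∧ x' < x) ∧ a = cell p σ Q y' x'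

theorem cell_eq_cell {p σ Q n y x y' x' : ℕ} [hp : Fact p.Prime] (hQ : n / p ^ σ < Q) (hx : x < n)
    (hx' : x' < n) (h : cell p σ Q y x = cell p σ Q y' x') : y = y' ∧ x = x' := by
  have hlt : ∀ z, z < n → z / p ^ σ < Q := fun z hz =>
    (Nat.div_le_div_right hz.le).trans_lt hQ
  have hl := label_lt hp.out.pos σ y x
  have hl' := label_lt hp.out.pos σ y' x'
  have hQ0 : 0 < Q := Nat.zero_lt_of_lt hQ
  have hN : 0 < p ^ σ := Nat.zero_lt_of_lt hl
  rw [cell, cell, mul_comm, mul_comm _ Q] at h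
  have h1 := congrArg (· / Q) h
  have h2 := congrArg (· % Q) h
  simp only [Nat.mul_add_div hQ0, Nat.mul_add_mod, Nat.mod_eq_of_lt (hlt x hx),
    Nat.mod_eq_of_lt (hlt x' hx'), Nat.div_eq_of_lt (hlt x hx), Nat.div_eq_of_lt (hlt x' hx'),
    add_zero] at h1 h2
  rw [mul_comm, mul_comm y'] at h1
  have h3 := congrArg (· / p ^ σ) h1
  have h4 := congrArg (· % p ^ σ) h1
  simp only [Nat.mul_add_div hN, Nat.mul_add_mod, Nat.mod_eq_of_lt hl, Nat.mod_eq_of_lt hl',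
    Nat.div_eq_of_lt hl, Nat.div_eq_of_lt hl', add_zero] at h3 h4
  subst h3
  exact ⟨rfl, eq_of_label_eq_of_div_eq h4 h2⟩

/-- Overwriting does no harm: by `cell_eq_cell`, distinct pairs have distinct cells. -/
theorem Filled.step {p σ Q n y x : ℕ} {mem : ℕ → ℕ} [hp : Fact p.Prime] (hQ : n / p ^ σ < Q)
    (hx : x < n) (h : Filled p σ Q n mem y x) :
    Filled p σ Q n (Function.update mem (cell p σ Q y x) (x + 1)) y (x + 1) := by
  refine ⟨fun y' x' hx' hor => ?_, fun a ha => ?_⟩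
  · rw [Function.update_apply]
    split_ifs with heq
    · rw [(cell_eq_cell hQ hx' hx heq).2]
    · refine h.1 y' x' hx' ?_
      rcases hor with hlt | ⟨rfl, hlt⟩
      · exact Or.inl hlt
      · rcases Nat.lt_succ_iff_lt_or_eq.1 hlt with hlt | rfl
        · exact Or.inr ⟨rfl, hlt⟩
        · exact absurd rfl heq
  · rw [Function.update_apply] at ha
    split_ifs at ha with heq
    · exact ⟨y, x, hx, Or.inr ⟨rfl, by omega⟩, heq⟩
    · obtain ⟨y', x', hx', hor, h'⟩ := h.2 a ha
      exact ⟨y', x', hx', by omega, h'⟩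

theorem Filled.next {p σ Q n y : ℕ} {mem : ℕ → ℕ} (h : Filled p σ Q n mem y n) :
    Filled p σ Q n mem (y + 1) 0 := by
  refine ⟨fun y' x' hx' hor => h.1 y' x' hx' (by omega), fun a ha => ?_⟩
  obtain ⟨y', x', hx', hor, h'⟩ := h.2 a ha
  exact ⟨y', x', hx', by omega, h'⟩

/-- For each point `y` and each element `x`, compute the label and store `x + 1` in the cell of `x`.
-/
def bucketProg : Prog :=
  (assign 17 (lit 0)).seq <| loop (op Op.lt (reg 17) (reg 12)) <|
    (assign 18 (lit 0)).seq <| (loop (op Op.lt (reg 18) (reg 0)) <|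
      shiftProg.seq <| digitsProg.seq <|
      (store ((reg 17 * reg 14 + reg 24) * reg 16 + reg 18 / reg 14) (reg 18 + lit 1)).seq
      (assign 18 (reg 18 + lit 1))).seq
    (assign 17 (reg 17 + lit 1))

theorem does_bucketProg {n p σ m Q : ℕ} [hp : Fact p.Prime] (hpn : p ≤ n) (hσm : σ ≤ m)
    (hm : ∀ x < n, (p.digits x).length ≤ m) (hQ : n / p ^ σ < Q) (hW : (n + p) ^ m < 2 ^ W)
    (hpW : p ^ σ < 2 ^ W) (hnW : n < 2 ^ W)
    (h0 : s.reg 0 = n) (h6 : s.reg 6 = σ) (h12 : s.reg 12 = p) (h14 : s.reg 14 = p ^ σ)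
    (h16 : s.reg 16 = Q) (hmem : ∀ a, s.mem a = 0) :
    Does W bucketProg s (p * (n * (200 * m + 500) + 100) + 100) fun s' =>
      (∀ j < 17, s'.reg j = s.reg j) ∧ s'.out = s.out ∧ Filled p σ Q n s'.mem p 0 := by
  have hp2 := hp.out.two_le
  refine Does.mono (Does.assign_seq ?_ (Does.loop (M := p)
    (I := fun s' => (∀ j < 17, s'.reg j = s.reg j) ∧ s'.out = s.out ∧ s'.reg 17 ≤ p ∧
      Filled p σ Q n s'.mem (s'.reg 17) 0) (fun s' => p - s'.reg 17) ?_ ?_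
    fun s₁ hI hc => Does.assign_seq ?_ (Does.seq (Does.loop (M := n)
      (I := fun s' => (∀ j < 17, s'.reg j = s.reg j) ∧ s'.out = s.out ∧ s'.reg 17 = s₁.reg 17 ∧
        s'.reg 18 ≤ n ∧ Filled p σ Q n s'.mem (s'.reg 17) (s'.reg 18)) (fun s' => n - s'.reg 18)
      ?_ ?_ fun s₂ hI₂ hc₂ => Does.seq (does_shiftProg (n := n) (p := p) (x := s₂.reg 18)
        (y := s₂.reg 17) (m := m) hp2 hpn ?_ ?_ ?_ hnW ?_ ?_ rfl rfl) fun s₃ h₃ =>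
        Does.seq (does_digitsProg (n := n) (p := p) (σ := σ) (x := s₂.reg 18)
          (y := s₂.reg 17) hp2 ?_ ?_ hpW ?_ ?_ ?_ h₃.2) fun s₄ h₄ =>
          Does.seq (R' := fun s' => s' =
            { s₄ with
              mem := Function.update s₄.mem (cell p σ Q (s₂.reg 17) (s₂.reg 18)) (s₂.reg 18 + 1) })
            (Does.store ?_ ?_) fun s₅ h₅ => Does.assign ?_ ?_)
      fun s₆ h₆ => Does.assign ?_ ?_))) ?_ ?_
  · simp
  · refine ⟨fun j hj => ?_, rfl, by simp, ⟨?_, ?_⟩⟩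
    · rw [State.reg_set, if_neg (by omega)]
    · simp
    · simp [hmem]
  · simp
  · simp
  all_goals
    try obtain ⟨hag, hout, h17, hfill⟩ := hI
    try
      have hlt : s₁.reg 17 < p := by
        rw [eval_lt_ne_zero] at hc
        simpa [hag, h12] using hc
  · refine ⟨fun j hj => ?_, hout, by simp, by simp, by simpa using hfill⟩
    rw [State.reg_set, if_neg (by omega)]; exact hag j hj
  · simp
  all_goals
    try obtain ⟨hag₂, hout₂, h17₂, h18₂, hfill₂⟩ := hI₂
    try
      have hlt₂ : s₂.reg 18 < n := by
        rw [eval_lt_ne_zero] at hc₂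
        simpa [hag₂, h0] using hc₂
  · exact hlt₂
  · exact hm _ hlt₂
  · exact (Nat.pow_le_pow_left (by omega) m).trans_lt hW
  · rw [hag₂ 0 (by norm_num), h0]
  · rw [hag₂ 12 (by norm_num), h12]
  · exact hlt₂
  · omega
  · rw [h₃.1.1 0 (by norm_num), hag₂ 0 (by norm_num), h0]
  · rw [h₃.1.1 6 (by norm_num), hag₂ 6 (by norm_num), h6]
  · rw [h₃.1.1 12 (by norm_num), hag₂ 12 (by norm_num), h12]
  all_goals
    try
      have hag₄ := h₄.1.trans h₃.1 le_rfl
      have h24 := h₄.2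
      obtain ⟨hr₄, hm₄, ho₄⟩ := hag₄
  · simp [hr₄]; omega
  · congr 2
    · simp [hr₄, hag₂, h14, h16, h24, cell]
    · simp [hr₄]
  · subst h₅
    simp [hr₄]; omega
  · subst h₅
    refine ⟨⟨fun j hj => ?_, ?_, ?_, ?_, ?_⟩, ?_⟩
    · rw [State.reg_set, if_neg (by omega)]
      exact (hr₄ j (by omega)).trans (hag₂ j hj)
    · exact ho₄.trans hout₂
    · simp [hr₄, h17₂]
    · simp [hr₄]; omega
    · simp [hr₄, hm₄]
      exact hfill₂.step hQ hlt₂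
    · simp [hr₄]; omega
  all_goals
    try
      obtain ⟨⟨hag₆, hout₆, h17₆, h18₆, hfill₆⟩, hc₆⟩ := h₆
      have hlast : s₆.reg 18 = n := by
        rw [eval_lt_eq_zero] at hc₆
        simp [hag₆, h0] at hc₆
        omega
  · simp; omega
  · refine ⟨⟨fun j hj => ?_, hout₆, ?_, ?_⟩, ?_⟩
    · rw [State.reg_set, if_neg (by omega)]; exact hag₆ j hj
    · simp; omega
    · rw [hlast] at hfill₆
      simpa using hfill₆.next
    · simp; omega
  · simp
    have h1 : 100 * σ ≤ 100 * m := by omega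
    have h2 : n * (9 + (100 * m + 100 + (100 * σ + 100 + 84))) ≤ n * (200 * m + 500) :=
      Nat.mul_le_mul_left _ (by omega)
    have h3 : p * (9 + (2 + (n * (9 + (100 * m + 100 + (100 * σ + 100 + 84))) + 9 + 10))) ≤
        p * (n * (200 * m + 500) + 100) := Nat.mul_le_mul_left _ (by omega)
    omega
  · rintro s' ⟨⟨hag, hout, h17, hfill⟩, hc⟩
    have hlast : s'.reg 17 = p := by
      rw [eval_lt_eq_zero] at hc
      simp [hag, h12] at hc
      omega
    exact ⟨hag, hout, hlast ▸ hfill⟩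

/-- The nonzero contents of the cells of the set number `l`. -/
def cellList (mem : ℕ → ℕ) (Q l : ℕ) : List ℕ :=
  ((List.range Q).map fun q => mem (l * Q + q)).filter (· ≠ 0)

/-- Write the nonzero contents of the cells of each set, and a zero after each set. -/
def outputProg : Prog :=
  (assign 17 (lit 0)).seq <| loop (op Op.lt (reg 17) (reg 12 * reg 14)) <|
    (assign 18 (lit 0)).seq <| (loop (op Op.lt (reg 18) (reg 16)) <|
      (assign 19 (load (reg 17 * reg 16 + reg 18))).seq <|
      (ite (reg 19) (write (reg 19)) nop).seq
      (assign 18 (reg 18 + lit 1))).seq <|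
    (write (lit 0)).seq (assign 17 (reg 17 + lit 1))

theorem does_outputProg {Q M : ℕ} (hW : M < 2 ^ W) (hQW : Q < 2 ^ W)
    (hM : s.reg 12 * s.reg 14 = M) (h16 : s.reg 16 = Q) :
    Does W outputProg s (M * (Q * 100 + 100) + 100) fun s' =>
      s'.out = s.out ++ (List.range M).flatMap fun l => cellList s.mem Q l ++ [0] := by
  intro hs
  have hsm := hs.2
  revert hs
  refine Does.mono (Does.assign_seq ?_ (Does.loop (M := M)
    (I := fun s' => (∀ j < 17, s'.reg j = s.reg j) ∧ s'.mem = s.mem ∧ s'.reg 17 ≤ M ∧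
      s'.out = s.out ++ (List.range (s'.reg 17)).flatMap fun l => cellList s.mem Q l ++ [0])
    (fun s' => M - s'.reg 17) ?_ ?_
    fun s₁ hI hc => Does.assign_seq ?_ (Does.seq (Does.loop (M := Q)
      (I := fun s' => (∀ j < 17, s'.reg j = s.reg j) ∧ s'.mem = s.mem ∧ s'.reg 17 = s₁.reg 17 ∧
        s'.reg 18 ≤ Q ∧ s'.out = s₁.out ++ ((List.range (s'.reg 18)).map fun q =>
          s.mem (s₁.reg 17 * Q + q)).filter (· ≠ 0))
      (fun s' => Q - s'.reg 18) ?_ ?_ fun s₂ hI₂ hc₂ => Does.assign_seq ?_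
        (Does.seq (R' := fun s' => (∀ j < 17, s'.reg j = s.reg j) ∧ s'.mem = s.mem ∧
            s'.reg 17 = s₁.reg 17 ∧ s'.reg 18 = s₂.reg 18 ∧
            s'.out = s₁.out ++ ((List.range (s₂.reg 18 + 1)).map fun q =>
              s.mem (s₁.reg 17 * Q + q)).filter (· ≠ 0))
          (Does.ite (T := 2) (fun h => (Does.write ?_).mono ?_ fun _ => id)
            fun h => (Does.nop ?_).mono ?_ fun _ => id) fun s₃ h₃ => Does.assign ?_ ?_))
      fun s₄ h₄ => Does.seq (R' := fun s' => s' = { s₄ with out := s₄.out ++ [0] })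
        (Does.write rfl) fun s₅ h₅ => Does.assign ?_ ?_))) ?_ ?_
  · simp
  · refine ⟨fun j hj => ?_, rfl, by simp, by simp⟩
    rw [State.reg_set, if_neg (by omega)]
  · simp
  · simp
  all_goals
    try obtain ⟨hag, hmem, h17, hout⟩ := hI
    try
      have hlt : s₁.reg 17 < M := by
        rw [eval_lt_ne_zero] at hc
        simpa [hag, hM] using hc
  · refine ⟨fun j hj => ?_, hmem, by simp, by simp, by simp⟩
    rw [State.reg_set, if_neg (by omega)]; exact hag j hj
  · simp
  all_goals
    try obtain ⟨hag₂, hmem₂, h17₂, h18₂, hout₂⟩ := hI₂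
    try
      have hlt₂ : s₂.reg 18 < Q := by
        rw [eval_lt_ne_zero] at hc₂
        simpa [hag₂, h16] using hc₂
  · simp [hmem₂]; exact hsm _
  · refine ⟨fun j hj => ?_, by simpa using hmem₂, by simpa using h17₂, by simp, ?_⟩
    · simp only [State.reg_set]
      rw [if_neg (by omega)]; exact hag₂ j hj
    · simp [hag₂, hmem₂, h16, h17₂] at h
      simp [hag₂, hmem₂, hout₂, h16, h17₂, List.range_succ, h]
  · simp
  · refine ⟨fun j hj => ?_, by simpa using hmem₂, by simpa using h17₂, by simp, ?_⟩
    · simp only [State.reg_set]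
      rw [if_neg (by omega)]; exact hag₂ j hj
    · simp [hag₂, hmem₂, h16, h17₂] at h
      simp [hout₂, List.range_succ, h]
  · simp
  all_goals
    try obtain ⟨hag₃, hmem₃, h17₃, h18₃, hout₃⟩ := h₃
  · simp; omega
  · refine ⟨⟨fun j hj => ?_, by simpa using hmem₃, by simpa using h17₃, ?_, ?_⟩, ?_⟩
    · simp only [State.reg_set]
      rw [if_neg (by omega)]; exact hag₃ j hj
    · simp; omega
    · simp only [State.out_set, State.reg_set, eval_add, eval_reg, eval_lit, if_true]
      rw [hout₃, h18₃]
    · simp; omega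
  all_goals
    try
      obtain ⟨⟨hag₄, hmem₄, h17₄, h18₄, hout₄⟩, hc₄⟩ := h₄
      have hlast : s₄.reg 18 = Q := by
        rw [eval_lt_eq_zero] at hc₄
        simp [hag₄, h16] at hc₄
        omega
      subst h₅
  · simp; omega
  · refine ⟨⟨fun j hj => ?_, by simpa using hmem₄, ?_, ?_⟩, ?_⟩
    · simp only [State.reg_set]
      rw [if_neg (by omega)]; exact hag₄ j hj
    · simp; omega
    · simp only [State.out_set, State.reg_set, eval_add, eval_reg, eval_lit, if_true]
      rw [hout₄, hlast, h17₄, hout, List.range_succ, List.flatMap_append]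
      simp [cellList]
    · simp; omega
  · simp
    have h1 : M * (20 + (2 + (Q * 49 + 9 + 12))) ≤ M * (Q * 100 + 100) :=
      Nat.mul_le_mul_left _ (by omega)
    omega
  · rintro s' ⟨⟨hag, hmem, h17, hout⟩, hc⟩
    have hlast : s'.reg 17 = M := by
      rw [eval_lt_eq_zero] at hc
      simp [hag, hM] at hc
      omega
    rw [hout, hlast]

/-! ### The whole program -/

/-- The program that writes a selector for the numbers `n`, `k`, `⌈1 / ε⌉` in registers 0, 1, 2. -/
def selectorProg : Prog :=
  sizeProg.seq <| (assign 5 (reg 2 * reg 3)).seq <| rootProg.seq <| boxProg.seq <|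
    primeProg.seq <| powProg.seq <| (assign 16 (reg 0 / reg 14 + lit 1)).seq <|
    bucketProg.seq outputProg

/-- The parameters that the program computes from `n`, `k`, `e`, together with the bounds that keep
all numbers short: `m` is the bit length of `n`, `σ` the number of Taylor coefficients, `2 ^ c` the
individual degree of the interpolating polynomial and `p` the size of the field. -/
structure IsParams (n k e m σ c p : ℕ) : Prop where
  two_le_n : 2 ≤ n
  k_lt : k < n
  e_pos : 0 < e
  size_eq : n.size = m
  le_pow : n ≤ (e * m) ^ σ ^ 2
  pow_lt : ∀ i < σ, (e * m) ^ i ^ 2 < n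
  lt_box : 32 * e * k < (2 ^ σ) ^ c
  box_le : ∀ i < c, (2 ^ σ) ^ i ≤ 32 * e * k
  prime : p.Prime
  lt_prime : 8 * e * σ * 2 ^ c * m < p
  prime_le : ∀ q, q.Prime → 8 * e * σ * 2 ^ c * m < q → p ≤ q
  σ_le : σ ≤ m
  two_mul_le : 2 * p ^ σ ≤ n
  pow_sq_le : (e * m) ^ σ ^ 2 ≤ n ^ 2
  pow_two_mul_le : (e * m) ^ (2 * σ + 1) ≤ n
  box_le_sq : (2 ^ σ) ^ c ≤ n ^ 2

variable {n k e m σ c p : ℕ}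

theorem IsParams.two_le_m (h : IsParams n k e m σ c p) : 2 ≤ m := by
  rw [← h.size_eq]
  exact Nat.lt_size.2 (by simpa using h.two_le_n)

theorem IsParams.σ_pos (h : IsParams n k e m σ c p) : 0 < σ := by
  rcases Nat.eq_zero_or_pos σ with rfl | h0
  · have := h.le_pow; have := h.two_le_n; simp at *; omega
  · exact h0

theorem IsParams.le_pow_σ (h : IsParams n k e m σ c p) : p ≤ p ^ σ :=
  Nat.le_self_pow h.σ_pos.ne' p

/-- The bound `W = (m + 2) ^ 2` on the bit lengths comes from the largest number, the value of a
digit polynomial with at most `m` coefficients at a point that is at most `n + p ≤ 2 ^ (m + 1)`. -/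
theorem does_selectorProg (h : IsParams n k e m σ c p) :
    Does ((m + 2) ^ 2) selectorProg (start [n, k, e]) (5000 * (p * n * m)) fun s' =>
      ∃ mem, Filled p σ (n / p ^ σ + 1) n mem p 0 ∧
        s'.out = (List.range (p * p ^ σ)).flatMap fun l =>
          cellList mem (n / p ^ σ + 1) l ++ [0] := by
  have : Fact p.Prime := ⟨h.prime⟩
  have hn2 := h.two_le_n
  have hm2 := h.two_le_m
  have hp2 := h.prime.two_le
  have hσ0 := h.σ_pos
  have hpσ := h.le_pow_σ
  have h2N := h.two_mul_le
  have he := h.e_pos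
  have hk := h.k_lt
  have hpn : p ≤ n := by omega
  have hnm : n < 2 ^ m := by rw [← h.size_eq]; exact Nat.lt_size_self n
  have hsq : n ^ 2 < 2 ^ (m + 2) ^ 2 := by
    calc n ^ 2 < (2 ^ m) ^ 2 := Nat.pow_lt_pow_left hnm (by norm_num)
      _ = 2 ^ (m * 2) := by rw [pow_mul]
      _ ≤ _ := Nat.pow_le_pow_right (by norm_num) (by nlinarith)
  have h2n : 2 * n ≤ n ^ 2 := by nlinarith
  have hW1 : n < 2 ^ (m + 2) ^ 2 := by omega
  have hβ2 : 2 ≤ e * m := le_trans hm2 (Nat.le_mul_of_pos_left m he)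
  have hβn : e * m ≤ n := le_trans (Nat.le_self_pow (by omega) _) h.pow_two_mul_le
  have hen : e ≤ n := le_trans (Nat.le_mul_of_pos_right e (by omega)) hβn
  have hpow : (n + p) ^ m < 2 ^ (m + 2) ^ 2 := by
    calc (n + p) ^ m ≤ (2 ^ (m + 1)) ^ m := Nat.pow_le_pow_left (by rw [pow_succ]; omega) m
      _ = 2 ^ ((m + 1) * m) := by rw [pow_mul]
      _ < _ := Nat.pow_lt_pow_right (by norm_num) (by nlinarith)
  have hPpos : 1 ≤ 8 * e * σ * 2 ^ c * m := Nat.one_le_iff_ne_zero.2 (by positivity)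
  have hcp : c ≤ p := by
    have h1 := h.lt_prime
    have h2 : 2 ^ c ≤ 8 * e * σ * 2 ^ c * m := by
      calc 2 ^ c = 1 * 1 * 2 ^ c * 1 := by ring
        _ ≤ 8 * e * σ * 2 ^ c * m := by gcongr <;> omega
    have h3 := Nat.lt_two_pow_self (n := c)
    omega
  have hdig : ∀ x < n, (p.digits x).length ≤ m := fun x hx =>
    (Nat.digits_length_le_iff (by omega) x).2
      (hx.trans_le (hnm.le.trans (Nat.pow_le_pow_left hp2 m)))
  set N := p ^ σ with hN
  have hdiv : n / N * N ≤ n := Nat.div_mul_le_self n N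
  have hQ : N * (n / N + 1) ≤ 2 * n := by nlinarith
  have hQn : n / N ≤ n := Nat.div_le_self n N
  have hpN : p * N < 2 ^ (m + 2) ^ 2 := by nlinarith
  refine Does.mono (Does.seq (does_sizeProg (n := n) (by omega) (by omega) rfl) fun s₁ h₁ =>
    Does.assign_seq ?_ <| Does.seq (does_rootProg (n := n) (β := e * m) (σ := σ) hβ2 h.le_pow
      h.pow_lt (h.pow_sq_le.trans_lt hsq) (h.pow_two_mul_le.trans_lt hW1) ?_ ?_) fun s₂ h₂ =>
    Does.seq (does_boxProg (k := k) (e := e) (z := 2 ^ σ) (c := c)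
      (Nat.le_self_pow hσ0.ne' 2) h.lt_box h.box_le (h.box_le_sq.trans_lt hsq) ?_ ?_ ?_)
      fun s₃ h₃ =>
    Does.seq (does_primeProg (P := 8 * e * σ * 2 ^ c * m) (p := p) hPpos h.prime h.lt_prime
      h.prime_le (by omega) ?_) fun s₄ h₄ =>
    Does.seq (does_powProg (p := p) (σ := σ) hp2 (by omega) ?_ ?_) fun s₅ h₅ =>
    Does.assign_seq ?_ <| Does.seq (does_bucketProg (n := n) (p := p) (σ := σ) (m := m)
      (Q := n / N + 1) hpn h.σ_le hdig (Nat.lt_succ_self _) hpow (by omega) hW1 ?_ ?_ ?_ ?_ ?_ ?_)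
      fun s₆ h₆ =>
    (does_outputProg (Q := n / N + 1) (M := p * N) hpN (by omega) ?_ ?_).mono le_rfl
      fun s₇ h₇ => ⟨s₆.mem, h₆.2.2, ?_⟩) ?_ fun _ => id
  all_goals
    try
      have r0 : s₁.reg 0 = n := h₁.1.1 0 (by norm_num)
      have r1 : s₁.reg 1 = k := h₁.1.1 1 (by norm_num)
      have r2 : s₁.reg 2 = e := h₁.1.1 2 (by norm_num)
      have r3 : s₁.reg 3 = m := h₁.2.trans h.size_eq
      have m₁ : s₁.mem = fun _ => 0 := h₁.1.2.1
      have o₁ : s₁.out = [] := h₁.1.2.2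
  · simp [r2, r3]; omega
  · simp [r0]
  · simp [r2, r3]
  · rw [h₂.1.1 1 (by norm_num)]; simp [r1]
  · rw [h₂.1.1 2 (by norm_num)]; simp [r2]
  · exact h₂.2.2
  all_goals try have a₃ := h₃.1.trans h₂.1 (by norm_num)
  · rw [h₃.1.1 6 (by norm_num), h₂.2.1, h₃.2, a₃.1 2 (by norm_num), a₃.1 3 (by norm_num)]
    simp [r2, r3]
  all_goals try have a₄ := h₄.1.trans a₃ (by norm_num)
  · rw [h₄.1.1 6 (by norm_num), h₃.1.1 6 (by norm_num), h₂.2.1]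
  · exact h₄.2
  all_goals try have a₅ := h₅.1.trans a₄ (by norm_num)
  · simp [a₅.1, r0, h₅.2, ← hN]; omega
  · simp [a₅.1, r0]
  · simp [h₅.1.1, h₄.1.1, h₃.1.1, h₂.2.1]
  · simp [h₅.1.1, h₄.2]
  · simp [h₅.2]
  · simp [a₅.1, r0, h₅.2, hN]
  · simp [a₅.2.1, m₁]
  · rw [h₆.1 12 (by norm_num), h₆.1 14 (by norm_num)]
    simp [h₅.1.1, h₄.2, h₅.2, hN]
  · rw [h₆.1 16 (by norm_num)]
    simp [a₅.1, r0, h₅.2, hN]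
  · have hσm := h.σ_le
    rw [h.size_eq]
    simp only [costWeight_mul, costWeight_reg, costWeight_add, costWeight_div, costWeight_lit,
      valueWeight_reg, valueWeight_div, valueWeight_lit]
    have e1 : p * N * ((n / N + 1) * 100 + 100) ≤ p * n * 300 := by
      have : p * N * ((n / N + 1) * 100 + 100) = p * (N * (n / N + 1) * 100 + N * 100) := by ring
      rw [this, mul_assoc p n]
      exact Nat.mul_le_mul_left p (by omega)
    have e2 : p * (n * (200 * m + 500) + 100) = 200 * (p * n * m) + 500 * (p * n) + 100 * p := by
      ring
    have e3 : p ^ 2 ≤ p * n := by rw [sq]; exact Nat.mul_le_mul_left p hpn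
    have e4 : p ≤ p * n := Nat.le_mul_of_pos_right p (by omega)
    have e5 : p * n ≤ p * n * m := Nat.le_mul_of_pos_right _ (by omega)
    have e6 : m ≤ p * n * m := Nat.le_mul_of_pos_left _ (by positivity)
    rw [e2]
    omega
  · rw [h₇, h₆.2.1]
    simp [a₅.2.2, o₁]

end LogRAM

/-! ### The family that is written -/

section Family

open LogRAM

/-- The set number `l` as a list of elements of `[n]`, read off the memory. -/
def cellFamily (n : ℕ) (mem : ℕ → ℕ) (Q l : ℕ) : List (Fin n) :=
  (List.range Q).filterMap fun q =>
    if h : (q < Q ∧ mem (l * Q + q) ≠ 0) ∧ mem (l * Q + q) - 1 < n then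
      some ⟨mem (l * Q + q) - 1, h.2⟩ else none

/-- The definition of `encodeFamily` inserts the coercion to `ℕ` by a monadic lift of the list; this
is the same with a plain map. -/
theorem encodeFamily_eq_flatMap {n : ℕ} (F : List (List (Fin n))) :
    encodeFamily F = F.flatMap fun l => l.map (fun x : Fin n => (x : ℕ) + 1) ++ [0] := by
  have hcoe : ∀ l : List (Fin n), (do let a ← l; pure (a : ℕ)) = l.map fun x : Fin n => (x : ℕ) :=
    fun l => by
    induction l with
    | nil => rfl
    | cons a l ih =>
      simp only [List.bind_eq_flatMap, List.flatMap_cons, List.pure_def, List.map_cons] at ih ⊢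
      rw [ih]; rfl
  simp only [encodeFamily, hcoe, List.map_map]
  rfl

variable {n p σ Q l : ℕ} {mem : ℕ → ℕ}

theorem mem_cellFamily {x : Fin n} :
    x ∈ cellFamily n mem Q l ↔ ∃ q < Q, mem (l * Q + q) = x + 1 := by
  simp only [cellFamily, List.mem_filterMap, List.mem_range, Option.dite_none_right_eq_some,
    Option.some.injEq]
  constructor
  · rintro ⟨q, hq, h, rfl⟩
    exact ⟨q, hq, by simp; omega⟩
  · rintro ⟨q, hq, h⟩
    exact ⟨q, hq, ⟨⟨hq, by omega⟩, by omega⟩, Fin.ext (by simp [h])⟩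

theorem LogRAM.Filled.le (hf : Filled p σ Q n mem p 0) (a : ℕ) : mem a ≤ n := by
  by_cases h : mem a = 0
  · omega
  · obtain ⟨y, x, hx, hor, rfl⟩ := hf.2 a h
    rw [hf.1 y x hx hor]; omega

theorem map_cellFamily (hf : Filled p σ Q n mem p 0) :
    (cellFamily n mem Q l).map (fun x : Fin n => (x : ℕ) + 1) = cellList mem Q l := by
  have : ∀ L : List ℕ, (∀ q ∈ L, q < Q) → (L.filterMap fun q =>
    if h : (q < Q ∧ mem (l * Q + q) ≠ 0) ∧ mem (l * Q + q) - 1 < n then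
      some (⟨mem (l * Q + q) - 1, h.2⟩ : Fin n) else none).map (fun x : Fin n => (x : ℕ) + 1) =
      (L.map fun q => mem (l * Q + q)).filter (· ≠ 0) := by
    intro L hL
    induction L with
    | nil => rfl
    | cons q L ih =>
      have ih := ih fun q hq => hL q (List.mem_cons_of_mem _ hq)
      have hq := hL q List.mem_cons_self
      have hle := hf.le (l * Q + q)
      by_cases h0 : mem (l * Q + q) = 0
      · rw [List.filterMap_cons_none (by simp [h0]), ih, List.map_cons, List.filter_cons_of_neg]
        simp [h0]
      · have h1 : (q < Q ∧ mem (l * Q + q) ≠ 0) ∧ mem (l * Q + q) - 1 < n := ⟨⟨hq, h0⟩, by omega⟩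
        rw [List.filterMap_cons_some (dif_pos h1), List.map_cons, ih, List.map_cons,
          List.filter_cons_of_pos (by simpa using h0)]
        congr 1
        simp; omega
  exact this _ fun q hq => List.mem_range.1 hq

theorem LogRAM.Filled.eq_cell (hf : Filled p σ Q n mem p 0) (hQ : n / p ^ σ < Q) {q x : ℕ}
    (hq : q < Q) (h : mem (l * Q + q) = x + 1) :
    q = x / p ^ σ ∧ x < n ∧ ∃ y < p, l = y * p ^ σ + label p σ y x := by
  obtain ⟨y, x', hx', hor, h'⟩ := hf.2 (l * Q + q) (by omega)
  rw [h', hf.1 y x' hx' hor] at h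
  obtain rfl : x' = x := by omega
  have hxQ : x' / p ^ σ < Q := (Nat.div_le_div_right hx'.le).trans_lt hQ
  have hQ0 : 0 < Q := by omega
  rw [cell, mul_comm, mul_comm _ Q] at h'
  have h1 := congrArg (· / Q) h'
  have h2 := congrArg (· % Q) h'
  simp only [Nat.mul_add_div hQ0, Nat.mul_add_mod, Nat.mod_eq_of_lt hq, Nat.div_eq_of_lt hq,
    Nat.mod_eq_of_lt hxQ, Nat.div_eq_of_lt hxQ, add_zero] at h1 h2
  exact ⟨h2, hx', y, by omega, h1⟩

theorem mem_cellFamily_iff_label_eq (hp : 0 < p) (hf : Filled p σ Q n mem p 0)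
    (hQ : n / p ^ σ < Q) {y b : ℕ} (hy : y < p) (hb : b < p ^ σ) {x : Fin n} :
    x ∈ cellFamily n mem Q (y * p ^ σ + b) ↔ label p σ y x = b := by
  rw [mem_cellFamily]
  constructor
  · rintro ⟨q, hq, h⟩
    obtain ⟨-, -, y', -, h'⟩ := hf.eq_cell hQ hq h
    have hN : 0 < p ^ σ := Nat.zero_lt_of_lt hb
    have hl := label_lt hp σ y' x
    rw [mul_comm, mul_comm y'] at h'
    have h3 := congrArg (· / p ^ σ) h'
    have h4 := congrArg (· % p ^ σ) h'
    simp only [Nat.mul_add_div hN, Nat.mul_add_mod, Nat.mod_eq_of_lt hl, Nat.mod_eq_of_lt hb,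
      Nat.div_eq_of_lt hl, Nat.div_eq_of_lt hb, add_zero] at h3 h4
    rw [h3, h4]
  · rintro rfl
    exact ⟨x / p ^ σ, (Nat.div_le_div_right x.2.le).trans_lt hQ, hf.1 y x x.2 (Or.inl hy)⟩

theorem nodup_cellFamily (hf : Filled p σ Q n mem p 0) (hQ : n / p ^ σ < Q) :
    (cellFamily n mem Q l).Nodup := by
  refine List.nodup_range.filterMap fun q q' x hx hx' => ?_
  have key : ∀ q, x ∈ (if h : (q < Q ∧ mem (l * Q + q) ≠ 0) ∧ mem (l * Q + q) - 1 < n then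
      some (⟨mem (l * Q + q) - 1, h.2⟩ : Fin n) else none) → q = x / p ^ σ := by
    intro q hq
    rw [Option.mem_def, Option.dite_none_right_eq_some] at hq
    obtain ⟨h, hx⟩ := hq
    rw [Option.some.injEq] at hx
    exact (hf.eq_cell hQ (l := l) (x := x) h.1.1 (by rw [← hx]; simp; omega)).1
  rw [key q hx, key q' hx']

variable [hp : Fact p.Prime]

/-- Each of the first two blocks of length `p ^ σ` contains an element of the set. -/
theorem two_le_length_cellFamily (hf : Filled p σ Q n mem p 0) (hQ : n / p ^ σ < Q)
    (hn : 2 * p ^ σ ≤ n) (hl : l < p * p ^ σ) : 2 ≤ (cellFamily n mem Q l).length := by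
  have hN : 0 < p ^ σ := pow_pos hp.out.pos σ
  have hb := Nat.mod_lt l hN
  have hy : l / p ^ σ < p := (Nat.div_lt_iff_lt_mul hN).2 hl
  have hl' : l = l / p ^ σ * p ^ σ + l % p ^ σ := (Nat.div_add_mod' l _).symm
  obtain ⟨x₀, h₀, h₀'⟩ := exists_label_eq (l / p ^ σ) 0 _ hb
  obtain ⟨x₁, h₁, h₁'⟩ := exists_label_eq (l / p ^ σ) 1 _ hb
  have hx₀ : x₀ < n := by
    have := (Nat.div_lt_iff_lt_mul hN (x := x₀) (y := 1)).1 (by omega)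
    omega
  have hx₁ : x₁ < n := by
    have := (Nat.div_lt_iff_lt_mul hN (x := x₁) (y := 2)).1 (by omega)
    omega
  have hcard : 1 < (cellFamily n mem Q l).toFinset.card := by
    rw [Finset.one_lt_card]
    refine ⟨⟨x₀, hx₀⟩, ?_, ⟨x₁, hx₁⟩, ?_, ?_⟩
    · rw [List.mem_toFinset, hl', mem_cellFamily_iff_label_eq hp.out.pos hf hQ hy hb]; exact h₀'
    · rw [List.mem_toFinset, hl', mem_cellFamily_iff_label_eq hp.out.pos hf hQ hy hb]; exact h₁'
    · intro heq
      have : x₀ = x₁ := congrArg Fin.val heq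
      rw [this] at h₀
      omega
  exact hcard.trans_le (List.toFinset_card_le _)

theorem isSelector_of_filled (hf : Filled p σ Q n mem p 0) (hQ : n / p ^ σ < Q) {k e c m : ℕ}
    {ε : ℝ} (hε : 0 < ε) (heε : 1 / ε ≤ e) (he : 0 < e) (hσ : 0 < σ) (hm : 0 < m)
    (hn : n ≤ 2 ^ m) (hw : 32 * e * k < (2 ^ c) ^ σ) (hpl : 8 * e * σ * 2 ^ c * m < p) :
    IsSelector n k ε (familyOf ((List.range (p * p ^ σ)).map (cellFamily n mem Q))) := by
  classical
  intro L S hdisj hL hLk hSk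
  have hL' : k < e * L.card := by
    have h1 : (k : ℝ) < e * L.card := by
      calc (k : ℝ) = 1 / ε * (ε * k) := by field_simp
        _ < 1 / ε * L.card := by gcongr
        _ ≤ e * L.card := by gcongr
    exact_mod_cast h1
  obtain ⟨x, hx, y, hy, hiso⟩ := exists_isolating_label (p := p) (n := n) (k := k) (e := e) (σ := σ)
    (h := 2 ^ c) (m := m) (L := L.map Fin.valEmbedding) (S := S.map Fin.valEmbedding) he hσ
    (by positivity) hm hn hw hpl (by simpa using hL') (by simpa using hLk) (by simpa using hSk)
    (by simp) (by simp)
  obtain ⟨x, hxL, rfl⟩ := Finset.mem_map.1 hx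
  have hb := label_lt hp.out.pos σ y x
  have hmem : ∀ z : Fin n, z ∈ (cellFamily n mem Q (y * p ^ σ + label p σ y x)).toFinset ↔
      label p σ y z = label p σ y x := fun z => by
    rw [List.mem_toFinset, mem_cellFamily_iff_label_eq hp.out.pos hf hQ hy hb]
  have huniq : ∀ z : Fin n, z ∈ (cellFamily n mem Q (y * p ^ σ + label p σ y x)).toFinset →
      z ∈ L ∨ z ∈ S → z = x := fun z hz hor => by
    refine Fin.ext (hiso z ?_ ((hmem z).1 hz).symm).symm
    rw [Finset.mem_union]
    exact hor.imp (Finset.mem_map_of_mem Fin.valEmbedding) (Finset.mem_map_of_mem Fin.valEmbedding)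
  refine ⟨_, ⟨_, List.mem_map.2 ⟨y * p ^ σ + label p σ y x, List.mem_range.2 ?_, rfl⟩, rfl⟩, ?_, ?_⟩
  · have := Nat.mul_le_mul_right (p ^ σ) (Nat.succ_le_of_lt hy)
    rw [Nat.succ_eq_add_one, add_mul] at this
    omega
  · rw [Finset.card_eq_one]
    refine ⟨x, Finset.eq_singleton_iff_unique_mem.2 ⟨?_, fun z hz => ?_⟩⟩
    · exact Finset.mem_inter.2 ⟨(hmem x).2 rfl, hxL⟩
    · exact huniq z (Finset.mem_inter.1 hz).1 (Or.inl (Finset.mem_inter.1 hz).2)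
  · rw [Finset.card_eq_zero, Finset.eq_empty_iff_forall_notMem]
    intro z hz
    obtain rfl := huniq z (Finset.mem_inter.1 hz).1 (Or.inr (Finset.mem_inter.1 hz).2)
    exact Finset.disjoint_left.1 hdisj hxL (Finset.mem_inter.1 hz).2

end Family

/-! ### The size of the parameters -/

section Parameters

open LogRAM

/-- The least `σ` with `n ≤ β ^ σ ^ 2`, about `√(log n / log β)`. It balances `β ^ σ`, the loss in
the number of sets, against `n ^ (1 / σ)`, which bounds the degree `h` and so enters the field size.
-/
noncomputable def rootExp (n β : ℕ) : ℕ := sInf {i | n ≤ β ^ i ^ 2}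

theorem le_pow_rootExp {n β : ℕ} (hβ : 2 ≤ β) : n ≤ β ^ rootExp n β ^ 2 := by
  refine Nat.sInf_mem (s := {i | n ≤ β ^ i ^ 2}) ⟨n, ?_⟩
  calc n ≤ 2 ^ n := Nat.lt_two_pow_self.le
    _ ≤ 2 ^ n ^ 2 := Nat.pow_le_pow_right (by norm_num) (Nat.le_self_pow (by norm_num) n)
    _ ≤ β ^ n ^ 2 := Nat.pow_le_pow_left hβ _

theorem pow_lt_of_lt_rootExp {n β i : ℕ} (hi : i < rootExp n β) : β ^ i ^ 2 < n :=
  not_le.1 fun h => Nat.notMem_of_lt_sInf hi h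

/-- With `β = e * m`, the field size is at most `β ^ (σ + 7)` and `p ^ σ ≤ k * β ^ (7 * σ + 6)`. The
exponent `100 * (σ + 1)` leaves ample room. -/
theorem exists_isParams {n k e m σ : ℕ} (hn : 2 ≤ n) (hk : 0 < k) (hkn : k < n) (he : 0 < e)
    (hm : n.size = m) (hσ : rootExp n (e * m) = σ) (hmax : k * (e * m) ^ (100 * (σ + 1)) ≤ n) :
    ∃ c p, IsParams n k e m σ c p ∧ p * p ^ σ ≤ k * (e * m) ^ (100 * (σ + 1)) ∧
      5000 * (p * n * m) * ((m + 2) ^ 2 + 1) ≤ n * (e * m) ^ (100 * (σ + 1)) := by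
  have hm2 : 2 ≤ m := by rw [← hm]; exact Nat.lt_size.2 (by simpa using hn)
  have hmβ : m ≤ e * m := Nat.le_mul_of_pos_left m he
  have heβ : e ≤ e * m := Nat.le_mul_of_pos_right e (by omega)
  have hem : e * m = m * e := mul_comm e m
  set β := e * m with hβ
  have hβ2 : 2 ≤ β := by omega
  have hσ1 : n ≤ β ^ σ ^ 2 := hσ ▸ le_pow_rootExp hβ2
  have hσ2 : ∀ i < σ, β ^ i ^ 2 < n := fun i hi => pow_lt_of_lt_rootExp (hσ.symm ▸ hi)
  have hσ0 : 0 < σ := by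
    rcases Nat.eq_zero_or_pos σ with rfl | h0
    · simp at hσ1; omega
    · exact h0
  have hβpow : ∀ {i j : ℕ}, i ≤ j → β ^ i ≤ β ^ j := fun h => Nat.pow_le_pow_right (by omega) h
  have hmono : ∀ i ≤ 100 * (σ + 1), k * β ^ i ≤ n := fun i hi =>
    (Nat.mul_le_mul_left k (hβpow hi)).trans hmax
  have hmono' : ∀ i ≤ 100 * (σ + 1), β ^ i ≤ n := fun i hi =>
    (Nat.le_mul_of_pos_left _ hk).trans (hmono i hi)
  have hnm : n < 2 ^ m := by rw [← hm]; exact Nat.lt_size_self n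
  have hσm : σ ≤ m := by
    have h1 := hσ2 (σ - 1) (by omega)
    have h2 : β ^ (σ - 1) ^ 2 < β ^ m := (h1.trans hnm).trans_le (Nat.pow_le_pow_left hβ2 m)
    have h3 := (Nat.pow_lt_pow_iff_right (by omega)).1 h2
    have h4 : σ - 1 ≤ (σ - 1) ^ 2 := Nat.le_self_pow (by norm_num) _
    omega
  have hpowsq : β ^ σ ^ 2 ≤ n ^ 2 := by
    have h1 : σ ^ 2 = (σ - 1) ^ 2 + (2 * σ - 1) := by
      obtain ⟨τ, rfl⟩ : ∃ τ, σ = τ + 1 := ⟨σ - 1, by omega⟩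
      rw [show 2 * (τ + 1) - 1 = 2 * τ + 1 by omega, Nat.add_sub_cancel]; ring
    rw [h1, pow_add, sq n]
    exact Nat.mul_le_mul (hσ2 _ (by omega)).le (hmono' _ (by omega))
  have h32 : 32 ≤ β ^ 5 := le_trans (by norm_num) (Nat.pow_le_pow_left hβ2 5)
  have h32e : 32 * e * k ≤ k * β ^ 6 := by
    calc 32 * e * k ≤ β ^ 5 * β * k := by gcongr
      _ = _ := by ring
  have hz : 2 ≤ 2 ^ σ := Nat.le_self_pow hσ0.ne' 2
  have hex : ∃ c, 32 * e * k < (2 ^ σ) ^ c :=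
    ⟨32 * e * k, Nat.lt_two_pow_self.trans_le (Nat.pow_le_pow_left hz _)⟩
  obtain ⟨c, hc1, hc2⟩ : ∃ c, 32 * e * k < (2 ^ σ) ^ c ∧ ∀ i < c, (2 ^ σ) ^ i ≤ 32 * e * k :=
    ⟨Nat.find hex, Nat.find_spec hex, fun i hi => not_lt.1 (Nat.find_min hex hi)⟩
  have hc0 : c ≠ 0 := by
    rintro rfl
    have : 0 < e * k := by positivity
    rw [pow_zero, mul_assoc] at hc1
    omega
  obtain ⟨d, rfl⟩ := Nat.exists_eq_succ_of_ne_zero hc0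
  have hd := hc2 d (by omega)
  have hdσ : (2 ^ d) ^ σ ≤ k * β ^ 6 := by
    rw [pow_right_comm]; exact hd.trans h32e
  have hdβ : 2 ^ d ≤ β ^ σ := by
    refine (Nat.pow_le_pow_iff_left hσ0.ne').1 ?_
    rw [← pow_mul β, ← sq]
    exact hdσ.trans ((hmono 6 (by omega)).trans hσ1)
  set P := 8 * e * σ * 2 ^ d.succ * m with hP
  have hP0 : P ≠ 0 := by positivity
  obtain ⟨q, hq, hPq, hq2⟩ := Nat.exists_prime_lt_and_le_two_mul P hP0
  have hexp : ∃ p, p.Prime ∧ P < p := ⟨q, hq, hPq⟩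
  obtain ⟨p, ⟨hp, hPp⟩, hpmin⟩ : ∃ p, (p.Prime ∧ P < p) ∧ ∀ r, r.Prime → P < r → p ≤ r :=
    ⟨Nat.find hexp, Nat.find_spec hexp, fun r hr hPr => Nat.find_min' hexp ⟨hr, hPr⟩⟩
  have hpd : p ≤ β ^ 7 * 2 ^ d := by
    calc p ≤ 2 * P := (hpmin q hq hPq).trans hq2
      _ = 32 * β * σ * 2 ^ d := by rw [hP, hβ, Nat.succ_eq_add_one, pow_succ]; ring
      _ ≤ β ^ 5 * β * β * 2 ^ d := by gcongr; omega
      _ = _ := by ring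
  have hpβ : p ≤ β ^ (σ + 7) := by
    calc p ≤ β ^ 7 * β ^ σ := hpd.trans (Nat.mul_le_mul_left _ hdβ)
      _ = _ := by ring
  have hpσ : p ^ σ ≤ k * β ^ (7 * σ + 6) := by
    calc p ^ σ ≤ (β ^ 7 * 2 ^ d) ^ σ := Nat.pow_le_pow_left hpd σ
      _ = β ^ (7 * σ) * (2 ^ d) ^ σ := by rw [mul_pow, ← pow_mul]
      _ ≤ β ^ (7 * σ) * (k * β ^ 6) := Nat.mul_le_mul_left _ hdσ
      _ = _ := by ring
  refine ⟨d.succ, p, ⟨hn, hkn, he, hm, hσ1, hσ2, hc1, hc2, hp, hPp, hpmin, hσm, ?_, hpowsq,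
    hmono' _ (by omega), ?_⟩, ?_, ?_⟩
  · calc 2 * p ^ σ ≤ β * (k * β ^ (7 * σ + 6)) := Nat.mul_le_mul hβ2 hpσ
      _ = k * β ^ (7 * σ + 7) := by ring
      _ ≤ n := hmono _ (by omega)
  · calc (2 ^ σ) ^ d.succ = (2 ^ σ) ^ d * 2 ^ σ := pow_succ _ _
      _ ≤ k * β ^ 6 * β ^ σ := Nat.mul_le_mul (hd.trans h32e) (Nat.pow_le_pow_left hβ2 σ)
      _ = k * β ^ (6 + σ) := by ring
      _ ≤ n := hmono _ (by omega)
      _ ≤ n ^ 2 := Nat.le_self_pow (by norm_num) n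
  · calc p * p ^ σ ≤ β ^ (σ + 7) * (k * β ^ (7 * σ + 6)) := Nat.mul_le_mul hpβ hpσ
      _ = k * β ^ (8 * σ + 13) := by ring
      _ ≤ _ := Nat.mul_le_mul_left k (hβpow (by omega))
  · have h5000 : 5000 ≤ β ^ 13 := le_trans (by norm_num) (Nat.pow_le_pow_left hβ2 13)
    have hm5 : (m + 2) ^ 2 + 1 ≤ β ^ 5 := by
      calc (m + 2) ^ 2 + 1 ≤ 2 ^ 3 * m ^ 2 := by nlinarith
        _ ≤ β ^ 3 * β ^ 2 := by gcongr
        _ = β ^ 5 := by ring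
    calc 5000 * (p * n * m) * ((m + 2) ^ 2 + 1)
        ≤ β ^ 13 * (β ^ (σ + 7) * n * β) * β ^ 5 := by gcongr
      _ = n * β ^ (σ + 26) := by ring
      _ ≤ _ := Nat.mul_le_mul_left n (hβpow (by omega))

end Parameters

/-! ### The loss is a vanishing power -/

section Asymptotics

theorem tendsto_log_size_div_log :
    Tendsto (fun n : ℕ => Real.log (2 * (n.size : ℝ)) / Real.log n) atTop (𝓝 0) := by
  have h1 : Tendsto (fun x : ℝ => Real.log x / x) atTop (𝓝 0) :=
    Real.isLittleO_log_id_atTop.tendsto_div_nhds_zero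
  have h2 : Tendsto (fun n : ℕ => 8 * Real.log n) atTop atTop :=
    (Real.tendsto_log_atTop.comp tendsto_natCast_atTop_atTop).const_mul_atTop (by norm_num)
  have h3 := (h1.comp h2).const_mul 8
  rw [mul_zero] at h3
  refine tendsto_of_tendsto_of_tendsto_of_le_of_le' tendsto_const_nhds h3 ?_ ?_
  · filter_upwards [eventually_ge_atTop 2] with n hn
    have hs : 1 ≤ n.size := Nat.lt_size.2 (by simp; omega)
    have hs' : (1 : ℝ) ≤ n.size := by exact_mod_cast hs
    exact div_nonneg (Real.log_nonneg (by linarith)) (Real.log_natCast_nonneg n)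
  · filter_upwards [eventually_ge_atTop 2] with n hn
    have hs : 1 ≤ n.size := Nat.lt_size.2 (by simp; omega)
    have hs' : (1 : ℝ) ≤ n.size := by exact_mod_cast hs
    have hlog2 : (1 / 2 : ℝ) < Real.log 2 := by linarith [Real.log_two_gt_d9]
    have hlogn : Real.log 2 ≤ Real.log n :=
      Real.log_le_log (by norm_num) (by exact_mod_cast hn)
    have h4 : ((n.size : ℝ) - 1) * Real.log 2 ≤ Real.log n := by
      have h5 : 2 ^ (n.size - 1) ≤ n := Nat.lt_size.1 (by omega)
      have h6 : ((2 : ℝ) ^ (n.size - 1)) ≤ n := by exact_mod_cast h5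
      have h7 := Real.log_le_log (by positivity) h6
      rw [Real.log_pow, Nat.cast_sub hs, Nat.cast_one] at h7
      exact h7
    have h8 : 2 * (n.size : ℝ) ≤ 8 * Real.log n := by nlinarith
    have h9 : Real.log (2 * (n.size : ℝ)) ≤ Real.log (8 * Real.log n) :=
      Real.log_le_log (by linarith) h8
    have hpos : 0 < Real.log n := by linarith
    simp only [Function.comp]
    rw [div_le_iff₀ hpos]
    calc Real.log (2 * (n.size : ℝ)) ≤ Real.log (8 * Real.log n) := h9
      _ = 8 * (Real.log (8 * Real.log n) / (8 * Real.log n)) * Real.log n := by field_simp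

/-- An upper bound for `log β / log n`, where `β = ⌈1 / ε⌉ * size n` and `n ^ (-ψ n) ≤ ε`. -/
noncomputable def loss (ψ : ℕ → ℝ) (n : ℕ) : ℝ :=
  |ψ n| + Real.log (2 * (n.size : ℝ)) / Real.log n

theorem tendsto_loss {ψ : ℕ → ℝ} (hψ : Tendsto ψ atTop (𝓝 0)) :
    Tendsto (fun n => 100 * (2 * loss ψ n + √(loss ψ n))) atTop (𝓝 0) := by
  have h1 : Tendsto (loss ψ) atTop (𝓝 0) := by
    have := hψ.abs.add tendsto_log_size_div_log
    change Tendsto (fun n : ℕ => |ψ n| + Real.log (2 * (n.size : ℝ)) / Real.log n) atTop (𝓝 0)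
    simpa using this
  have h2 := ((h1.const_mul 2).add ((Real.continuous_sqrt.tendsto 0).comp h1)).const_mul 100
  simpa using h2

/-- The loss `β ^ (100 * (σ + 1))` is at most `n ^ (100 * (2 * θ + √θ))`, where `θ = loss ψ n`: by
the minimality of `σ`, `(σ - 1) ^ 2 * log β < log n`, hence `(σ - 1) * log β ≤ √θ * log n`. -/
theorem pow_rootExp_le_rpow {ψ : ℕ → ℝ} {n : ℕ} {ε : ℝ} (hn : 2 ≤ n)
    (hε : (n : ℝ) ^ (-ψ n) ≤ ε) :
    (((⌈1 / ε⌉₊ * n.size) ^ (100 * (rootExp n (⌈1 / ε⌉₊ * n.size) + 1)) : ℕ) : ℝ) ≤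
      (n : ℝ) ^ (100 * (2 * loss ψ n + √(loss ψ n))) := by
  have hn0 : (0 : ℝ) < n := by positivity
  have hn1 : (1 : ℝ) ≤ n := by exact_mod_cast (by omega : 1 ≤ n)
  have hlogn : 0 < Real.log n := Real.log_pos (by exact_mod_cast (by omega : 1 < n))
  have hε0 : 0 < ε := (Real.rpow_pos_of_pos hn0 _).trans_le hε
  have hs : 2 ≤ n.size := Nat.lt_size.2 (by simpa using hn)
  have hs' : (2 : ℝ) ≤ n.size := by exact_mod_cast hs
  have he : 0 < ⌈1 / ε⌉₊ := Nat.ceil_pos.2 (by positivity)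
  have he' : (⌈1 / ε⌉₊ : ℝ) ≤ 2 * (n : ℝ) ^ |ψ n| := by
    have h1 : 1 / ε ≤ (n : ℝ) ^ ψ n := by
      rw [Real.rpow_neg hn0.le] at hε
      rw [div_le_iff₀ hε0]
      have h2 := Real.rpow_pos_of_pos hn0 (ψ n)
      calc (1 : ℝ) = (n : ℝ) ^ ψ n * ((n : ℝ) ^ ψ n)⁻¹ := by field_simp
        _ ≤ _ := by gcongr
    have h2 : (n : ℝ) ^ ψ n ≤ (n : ℝ) ^ |ψ n| :=
      Real.rpow_le_rpow_of_exponent_le hn1 (le_abs_self _)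
    have h3 : 1 ≤ (n : ℝ) ^ |ψ n| := Real.one_le_rpow hn1 (abs_nonneg _)
    have h4 := (Nat.ceil_lt_add_one (by positivity : 0 ≤ 1 / ε)).le
    linarith
  set e := ⌈1 / ε⌉₊ with hedef
  set β := e * n.size with hβ
  set σ := rootExp n β with hσ
  have hβ2 : 2 ≤ β := le_trans hs (Nat.le_mul_of_pos_left _ he)
  have hβ0 : (0 : ℝ) < β := by positivity
  have hlogβ : Real.log β ≤ loss ψ n * Real.log n := by
    have h1 : (β : ℝ) ≤ (n : ℝ) ^ |ψ n| * (2 * n.size) := by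
      rw [hβ, Nat.cast_mul]
      calc (e : ℝ) * n.size ≤ 2 * (n : ℝ) ^ |ψ n| * n.size := by gcongr
        _ = _ := by ring
    have h2 := Real.log_le_log hβ0 h1
    rw [Real.log_mul (Real.rpow_pos_of_pos hn0 _).ne' (by positivity), Real.log_rpow hn0] at h2
    rw [loss, add_mul, div_mul_cancel₀ _ hlogn.ne']
    exact h2
  have hlogβ0 : 0 < Real.log β := Real.log_pos (by exact_mod_cast (by omega : 1 < β))
  have hloss : 0 ≤ loss ψ n := by
    by_contra h
    nlinarith
  have hσ0 : σ ≠ 0 := by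
    intro h0
    have := le_pow_rootExp (n := n) hβ2
    rw [← hσ, h0] at this
    simp at this; omega
  have hτ : ((σ : ℝ) - 1) * Real.log β ≤ √(loss ψ n) * Real.log n := by
    have h1 := pow_lt_of_lt_rootExp (n := n) (β := β) (i := σ - 1) (by omega)
    have h2 : ((β : ℝ) ^ (σ - 1) ^ 2) ≤ n := by exact_mod_cast h1.le
    have h3 := Real.log_le_log (by positivity) h2
    rw [Real.log_pow, Nat.cast_pow, Nat.cast_sub (by omega), Nat.cast_one] at h3
    refine abs_le_of_sq_le_sq' ?_ (by positivity) |>.2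
    rw [mul_pow, mul_pow, Real.sq_sqrt hloss]
    calc ((σ : ℝ) - 1) ^ 2 * Real.log β ^ 2 =
        (((σ : ℝ) - 1) ^ 2 * Real.log β) * Real.log β := by ring
      _ ≤ Real.log n * (loss ψ n * Real.log n) := by gcongr
      _ = _ := by ring
  rw [← Real.log_le_log_iff (by positivity) (Real.rpow_pos_of_pos hn0 _), Real.log_rpow hn0,
    Nat.cast_pow, Real.log_pow]
  push_cast
  nlinarith

end Asymptotics

theorem theorem1p8 :
    ∃ (P : LogRAM.Prog) (kmax : ℕ → ℝ → ℝ),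
      ∀ ψ : ℕ → ℝ, Tendsto ψ atTop (𝓝 0) →
      ∃ g : ℕ → ℝ, Tendsto g atTop (𝓝 0) ∧
        ∀ (n : ℕ) (ε : ℝ), (n : ℝ) ^ (-ψ n) ≤ ε → ε ≤ 1 →
          (n : ℝ) ^ (1 - g n) ≤ kmax n ε ∧
          ∀ k : ℕ, 0 < k → k < n → (k : ℝ) ≤ kmax n ε →
            ∃ (F : List (List (Fin n))) (t : ℕ) (s : LogRAM.State),
              LogRAM.Runs P (LogRAM.start [n, k, ⌈1 / ε⌉₊]) t s ∧
              s.out = encodeFamily F ∧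
              (∀ U ∈ F, U.Nodup ∧ 2 ≤ U.length) ∧
              IsSelector n k ε (familyOf F) ∧
              (F.length : ℝ) ≤ k * (n : ℝ) ^ (g n) ∧
              (t : ℝ) ≤ (n : ℝ) ^ (1 + g n) := by
  let X : ℕ → ℝ → ℕ := fun n ε =>
    (⌈1 / ε⌉₊ * n.size) ^ (100 * (rootExp n (⌈1 / ε⌉₊ * n.size) + 1))
  -- for `n < 2` there is no `k` with `0 < k < n`, and `1` is an upper bound for any power of `n`
  refine ⟨LogRAM.selectorProg, fun n ε => if n < 2 then 1 else n / X n ε, fun ψ hψ =>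
    ⟨fun n => 100 * (2 * loss ψ n + √(loss ψ n)), tendsto_loss hψ, fun n ε hε _ => ?_⟩⟩
  dsimp only
  split_ifs with hn
  · refine ⟨?_, fun k hk hkn => by omega⟩
    interval_cases n
    · rcases eq_or_ne (1 - 100 * (2 * loss ψ 0 + √(loss ψ 0))) 0 with h | h
      · rw [h, Real.rpow_zero]
      · rw [Nat.cast_zero, Real.zero_rpow h]; norm_num
    · simp
  push Not at hn
  have hX := pow_rootExp_le_rpow hn hε
  change ((X n ε : ℕ) : ℝ) ≤ _ at hX
  set g := 100 * (2 * loss ψ n + √(loss ψ n))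
  have hn0 : (0 : ℝ) < n := by positivity
  have hε0 : 0 < ε := (Real.rpow_pos_of_pos hn0 _).trans_le hε
  have he : 0 < ⌈1 / ε⌉₊ := Nat.ceil_pos.2 (by positivity)
  have hs : 0 < n.size := Nat.size_pos.2 (by omega)
  have hX0 : 0 < X n ε := by positivity
  have hX0' : (0 : ℝ) < X n ε := by exact_mod_cast hX0
  refine ⟨?_, fun k hk hkn hkmax => ?_⟩
  · rw [Real.rpow_sub hn0, Real.rpow_one]
    gcongr
  · have hmax : k * X n ε ≤ n := by
      rw [le_div_iff₀ hX0'] at hkmax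
      exact_mod_cast hkmax
    obtain ⟨c, p, hpar, hsets, htime⟩ := exists_isParams hn hk hkn he rfl rfl hmax
    have hcost : 5000 * (p * n * n.size) * ((n.size + 2) ^ 2 + 1) ≤ n * X n ε := htime
    have : Fact p.Prime := ⟨hpar.prime⟩
    have hsmall : (LogRAM.start [n, k, ⌈1 / ε⌉₊]).Small ((n.size + 2) ^ 2) := by
      have hlt : n < 2 ^ (n.size + 2) ^ 2 := (Nat.lt_size_self n).trans_le
        (Nat.pow_le_pow_right (by norm_num) (by nlinarith))
      have hle : ⌈1 / ε⌉₊ ≤ n := le_trans (Nat.le_mul_of_pos_right _ hs)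
        (le_trans (Nat.le_self_pow (by omega) _) hpar.pow_two_mul_le)
      refine ⟨fun i => ?_, fun a => by simp [LogRAM.start]⟩
      match i with
      | 0 => simpa [LogRAM.start] using hlt
      | 1 => simp [LogRAM.start]; omega
      | 2 => simp only [LogRAM.start, List.getD_cons_succ, List.getD_cons_zero]; omega
      | i + 3 => simp [LogRAM.start]
    obtain ⟨t, s, hrun, ht, -, mem, hfill, hout⟩ := LogRAM.does_selectorProg hpar hsmall
    have hQ : n / p ^ rootExp n (⌈1 / ε⌉₊ * n.size) <
      n / p ^ rootExp n (⌈1 / ε⌉₊ * n.size) + 1 := Nat.lt_succ_self _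
    refine ⟨_, t, s, hrun, ?_, ?_, isSelector_of_filled hfill hQ (c := c) (m := n.size) hε0
      (Nat.le_ceil _) he hpar.σ_pos hs (Nat.lt_size_self n).le ?_ hpar.lt_prime, ?_, ?_⟩
    · rw [hout, encodeFamily_eq_flatMap, List.flatMap_map]
      congr 1
      funext l
      rw [map_cellFamily hfill]
    · intro U hU
      obtain ⟨l, hl, rfl⟩ := List.mem_map.1 hU
      exact ⟨nodup_cellFamily hfill hQ,
        two_le_length_cellFamily hfill hQ hpar.two_mul_le (List.mem_range.1 hl)⟩
    · rw [pow_right_comm]; exact hpar.lt_box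
    · rw [List.length_map, List.length_range]
      calc ((p * p ^ rootExp n (⌈1 / ε⌉₊ * n.size) : ℕ) : ℝ) ≤ ((k * X n ε : ℕ) : ℝ) := by
            exact_mod_cast hsets
        _ = k * (X n ε : ℝ) := by push_cast; rfl
        _ ≤ _ := by gcongr
    · calc (t : ℝ) ≤ ((n * X n ε : ℕ) : ℝ) := by exact_mod_cast ht.trans hcost
        _ = n * (X n ε : ℝ) := by push_cast; rfl
        _ ≤ n * (n : ℝ) ^ g := by gcongr
        _ = (n : ℝ) ^ (1 + g) := by rw [Real.rpow_add hn0, Real.rpow_one]
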